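/- Let $K$ be any field, let $n\ge c\ge 1$ and $t\ge v\ge 0$ be integers, and let $R=K[x_0,\dots,x_n]$. Let $\underline h=(h_0,\dots,h_v)$ be an O-sequence with $h_v\ne 0$ and $h_1\le c$ (where $h_i:=0$ for $i>v$); that is, $h_0=1$ and $h_{i+1}\le h_i^{\langle i\rangle}$ for all $i\ge 1$, where $a^{\langle i\rangle}=\binom{k_i+1}{i+1}+\dots+\binom{k_j+1}{j+1}$ if $a=\binom{k_i}{i}+\dots+\binom{k_j}{j}$ with $k_i>\dots>k_j\ge j\ge1$, and $0^{\langle i\rangle}=0$. *Decomposition of $\underline h$.* Let $c\ge 2$ and let $J$ be the Artinian lex-segment ideal of $T=K[z_1,\dots,z_c]$ for which $T/J$ has Hilbert function $\underline h$ (a monomial ideal is a lex-segment ideal if with a monomial it contains all larger monomials of the same degree in the degree-lexicographic order with $z_1>\dots>z_c$). Let $\alpha$ be the initial degree of $J$ and write $J=\sum_{j=0}^{\alpha} z_1^j I_j$, where the $I_j$ are generated by ideals of $\bar T=K[z_2,\dots,z_c]$ and $I_0\subset I_1\subset\dots\subset I_{\alpha-1}\subsetneq I_\alpha=T$; so $I_j\cap\bar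 T=\{f\in\bar T : z_1^jf\in J\}$. Let $\underline h^j$ be the Hilbert function of $\bar T/(I_j\cap\bar T)$ for $0\le j<\alpha$. Then $(\underline h^0,\dots,\underline h^{\alpha-1})$ is the decomposition of $\underline h$. *The ideals.* Let $\mathcal M_{c,t}=\{M_0,\dots,M_{t+\lfloor\frac{c-1}{2}\rfloor},L_0,\dots,L_{t+\lfloor\frac{c-2}{2}\rfloor}\}\subset R$ be a family of $2t+c$ linear forms such that every subfamily of at most $c+1$ elements is linearly independent over $K$. Define $I_{c,t}(\underline h)$ recursively: if $c=1$, then $I_{1,t}(\underline h)=(M_{t-v}M_{t-v+1}\cdots M_t)$; if $c>1$, then $$I_{c,t}(\underline h)=\bigcap_{j=0}^{\alpha-1}\bigl[I_{c-1,t-j}(\underline h^j)+(L_{t-j+\frac{c-2}{2}})\bigr]\ (c\text{ even}),\qquad I_{c,t}(\underline h)=\bigcap_{j=0}^{\alpha-1}\bigl[I_{c-1,t-j}(\underline h^j)+(M_{t-j+\frac{c-1}{2}})\bigr]\ (c\text{ odd}).$$ Let $Z_{c,t}\subset\mathbb P^n$ be the subscheme defined by the ideal $$\bigcap_{0\le i_1\le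 i_2<i_3\le i_4<\cdots\,;\ i_c\le t+\lfloor\frac{c-1}{2}\rfloor}(M_{i_1},L_{i_2},M_{i_3},L_{i_4},\dots)\qquad(c\text{ generators each}).$$ **Theorem.** 1. $I_{c,t}(\underline h)$ is the (saturated, homogeneous) ideal of a reduced arithmetically Cohen–Macaulay subscheme $Z_{c,t}(\underline h)\subset\mathbb P^n$ of codimension $c$, with $Z_{c,t}(\underline h)\subset Z_{c,t}$ (that is, $I_{Z_{c,t}}\subset I_{c,t}(\underline h)$), whose $h$-vector is $\underline h$. Here the $h$-vector of a graded Cohen–Macaulay ring $A=R/I$ of dimension $D$ is the Hilbert function of an Artinian reduction of $A$, i.e. of a quotient of $A$ by a regular sequence of $D$ linear forms; equivalently, and also when such a sequence does not exist over the given finite field, it is the coefficient sequence of $(1-z)^D\sum_i \dim_K[A]_i\,z^i$. 2. If moreover every subfamily of at most $c+2$ elements of $\mathcal M_{c,t}$ is linearly independent, then $Z_{c,t}(\underline h)$ is a generalized stick figure: it is a union of linear subvarieties of the same dimension $d$, and any three different components meet in dimension at most $d-2$ (the empty set having dimension $-1$). 3. If $\underline h'=(h'_0,\dots,h'_{v'})$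 is an O-sequence with $h'_{v'}\ne0$, $v'\le v$ and $h'_i\le h_i$ for $0\le i\le v'$, then $Z_{c,t}(\underline h')\subset Z_{c,t}(\underline h)$ (that is, $I_{c,t}(\underline h)\subset I_{c,t}(\underline h')$). -/

import Mathlib

namespace LexConfig

open MvPolynomial

/-! ### O-sequences -/

/-- The number `a^{<i>}`: if `a = C(k_i, i) + C(k_{i-1}, i-1) + ... + C(k_j, j)` with
`k_i > k_{i-1} > ... > k_j ≥ j ≥ 1` is the `i`-binomial expansion of `a` (whose leading `k_i` is the
largest `k` with `C(k, i) ≤ a`), then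
`a^{<i>} = C(k_i + 1, i + 1) + C(k_{i-1} + 1, i) + ... + C(k_j + 1, j + 1)`; and `0^{<i>} = 0`. -/
def macaulayBound : ℕ → ℕ → ℕ
  | 0, _ => 0
  | i + 1, a =>
    if a = 0 then 0
    else
      (Nat.findGreatest (fun k => k.choose (i + 1) ≤ a) (a + i + 1) + 1).choose (i + 2) +
        macaulayBound i
          (a - (Nat.findGreatest (fun k => k.choose (i + 1) ≤ a) (a + i + 1)).choose (i + 1))

/-- O-sequences: `h_0 = 1` and `h_{i+1} ≤ h_i^{<i>}` for all `i ≥ 1`. A finite sequence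
`(h_0, ..., h_v)` is regarded as a function on `ℕ` vanishing beyond `v`. -/
def IsOSequence (h : ℕ → ℕ) : Prop :=
  h 0 = 1 ∧ ∀ i, 1 ≤ i → h (i + 1) ≤ macaulayBound i (h i)

/-- The last degree in which a finite sequence is nonzero. -/
noncomputable def lastDegree (h : ℕ → ℕ) : ℕ := sSup {i | h i ≠ 0}

section Ideals

variable {K : Type*} [Field K]

/-- The Hilbert function of `K[X_0, ..., X_{N-1}] / I` for a homogeneous ideal `I`: in degree `d`, the
dimension of the image in the quotient of the space of forms of degree `d`. -/
noncomputable def hilbertFn {N : ℕ} (I : Ideal (MvPolynomial (Fin N) K)) (d : ℕ) : ℕ :=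
  Module.finrank K
    ((homogeneousSubmodule (Fin N) K d).map (Ideal.Quotient.mkₐ K I).toLinearMap)

/-! ### Lex-segment ideals and the decomposition of an O-sequence -/

/-- Lex-segment ideals of `T = K[z_1, ..., z_c]`: monomial ideals which contain, with a monomial,
every larger monomial of the same degree, for the degree-lexicographic order with
`z_1 > z_2 > ... > z_c`. -/
def IsLexSegment {c : ℕ} (J : Ideal (MvPolynomial (Fin c) K)) : Prop :=
  (∃ S : Set (Fin c →₀ ℕ), J = Ideal.span ((fun m => monomial m (1 : K)) '' S)) ∧
  ∀ m₁ m₂ : Fin c →₀ ℕ, m₁.degree = m₂.degree → toDegLex m₂ < toDegLex m₁ →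
    monomial m₂ (1 : K) ∈ J → monomial m₁ (1 : K) ∈ J

variable (K) in
/-- The Artinian lex-segment ideal `J` of `T = K[z_1, ..., z_c]` such that `T / J` has Hilbert
function `h`. -/
noncomputable def lexIdeal (c : ℕ) (h : ℕ → ℕ) : Ideal (MvPolynomial (Fin c) K) :=
  Classical.epsilon fun J => IsLexSegment J ∧ IsArtinianRing (MvPolynomial (Fin c) K ⧸ J) ∧
    ∀ d, hilbertFn J d = h d

/-- The initial degree of an ideal: the least degree of a nonzero form in it. -/
noncomputable def initialDegree {N : ℕ} (J : Ideal (MvPolynomial (Fin N) K)) : ℕ :=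
  sInf {d | ∃ f ∈ J, f ≠ 0 ∧ f.IsHomogeneous d}

/-- For an ideal `J` of `K[z_1, ..., z_{c+1}]`, the ideal of all `f` in `K[z_2, ..., z_{c+1}]` such
that `z_1^j f ∈ J`. By `slice_eq` it is the `j`-th ideal in any decomposition
`J = ∑_j z_1^j I_j` with `I_0 ⊆ I_1 ⊆ ...`. -/
noncomputable def slice {c : ℕ} (J : Ideal (MvPolynomial (Fin (c + 1)) K)) (j : ℕ) :
    Ideal (MvPolynomial (Fin c) K) where
  carrier := {f | X 0 ^ j * rename Fin.succ f ∈ J}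
  zero_mem' := by simp
  add_mem' := by
    intro a b ha hb
    simp only [Set.mem_ofPred_eq, map_add, mul_add] at *
    exact J.add_mem ha hb
  smul_mem' := by
    intro a f hf
    simp only [Set.mem_ofPred_eq, smul_eq_mul, map_mul] at *
    have h := J.mul_mem_left (rename Fin.succ a) hf
    rwa [mul_left_comm] at h

/-- Uniqueness of the decomposition `J = ∑_j z_1^j I_j` with `I_0 ⊆ I_1 ⊆ ...`. -/
theorem slice_eq {c : ℕ} (J : Ideal (MvPolynomial (Fin (c + 1)) K))
    (I : ℕ → Ideal (MvPolynomial (Fin c) K)) (hI : Monotone I)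
    (hJ : J = ⨆ j, Ideal.span {X 0 ^ j} *
      (I j).map (rename Fin.succ : MvPolynomial (Fin c) K →ₐ[K] _)) (j : ℕ) :
    slice J j = I j := by
  have hs : ∀ f : MvPolynomial (Fin c) K,
      finSuccEquiv K c (rename Fin.succ f) = Polynomial.C f := fun f => by
    induction f using MvPolynomial.induction_on with
    | C a => rw [rename_C, finSuccEquiv_apply]; simp
    | add p q hp hq => simp [hp, hq]
    | mul_X p i hp => rw [map_mul, map_mul, hp, rename_X, finSuccEquiv_X_succ, map_mul]
  let N : Ideal (Polynomial (MvPolynomial (Fin c) K)) :=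
    { carrier := {p | ∀ k, p.coeff k ∈ I k}
      zero_mem' := fun k => by simp
      add_mem' := fun {p q} hp hq k => by
        rw [Polynomial.coeff_add]; exact (I k).add_mem (hp k) (hq k)
      smul_mem' := fun p q hq k => by
        rw [smul_eq_mul, Polynomial.coeff_mul]
        refine (I k).sum_mem fun x hx => (I k).mul_mem_left _ ?_
        have h2 : x.2 ≤ k := by have := Finset.HasAntidiagonal.mem_antidiagonal.mp hx; omega
        exact hI h2 (hq x.2) }
  have hJN : J ≤ N.comap (finSuccEquiv K c) := by
    rw [hJ]
    refine iSup_le fun i => ?_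
    rw [Ideal.mul_le]
    intro r hr s hs'
    obtain ⟨a, rfl⟩ := Ideal.mem_span_singleton'.mp hr
    have h1 : s ∈ (N.comap (finSuccEquiv K c)).colon ((Ideal.span {X 0 ^ i} : Ideal (MvPolynomial (Fin (c + 1)) K)) : Set _) := by
      refine Ideal.map_le_iff_le_comap.mpr (fun f hf => ?_) hs'
      rw [Ideal.mem_comap, Submodule.mem_colon]
      intro p hp
      obtain ⟨b, rfl⟩ := Ideal.mem_span_singleton'.mp hp
      rw [smul_eq_mul, mul_left_comm]
      refine Ideal.mul_mem_left _ _ ?_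
      rw [Ideal.mem_comap, map_mul, map_pow, finSuccEquiv_X_zero]
      intro k
      erw [hs]
      rw [Polynomial.coeff_C_mul, Polynomial.coeff_X_pow]
      split_ifs with hk
      · subst hk; simpa using hf
      · simp
    have h2 := Submodule.mem_colon.mp h1 (a * X 0 ^ i) hr
    rwa [smul_eq_mul, mul_comm] at h2
  ext f
  constructor
  · intro hf
    have h1 := hJN (show X 0 ^ j * rename Fin.succ f ∈ J from hf) j
    rw [map_mul, map_pow, finSuccEquiv_X_zero, hs, Polynomial.coeff_X_pow_mul'] at h1
    simpa using h1
  · intro hf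
    change X 0 ^ j * rename Fin.succ f ∈ J
    rw [hJ]
    refine (le_iSup (fun j => Ideal.span {X 0 ^ j} *
      (I j).map (rename Fin.succ : MvPolynomial (Fin c) K →ₐ[K] _)) j :)
      (Ideal.mul_mem_mul (Ideal.mem_span_singleton_self _) (Ideal.mem_map_of_mem _ hf))

/-- The decomposition `(h^0, ..., h^{α-1})` of `h`, where `h_1 ≤ c + 1`: with `J` the Artinian
lex-segment ideal of `T = K[z_1, ..., z_{c+1}]` with Hilbert function `h` and
`J = ∑_j z_1^j I_j`, the sequence `h^j` is the Hilbert function of `K[z_2, ..., z_{c+1}] / I_j`. -/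
noncomputable def decomp (K : Type*) [Field K] (c : ℕ) (h : ℕ → ℕ) (j : ℕ) : ℕ → ℕ :=
  hilbertFn (slice (lexIdeal K (c + 1) h) j)

/-! ### The configurations -/

variable {n : ℕ}

/-- The ideal `I_{c,t}(h)`, for `c ≥ 1` (the value for `c = 0` is not used). -/
noncomputable def configIdeal (M L : ℕ → MvPolynomial (Fin (n + 1)) K) :
    ℕ → ℕ → (ℕ → ℕ) → Ideal (MvPolynomial (Fin (n + 1)) K)
  | 0, _, _ => ⊥
  | 1, t, h => Ideal.span {∏ i ∈ Finset.Icc (t - lastDegree h) t, M i}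
  | c + 2, t, h =>
    ⨅ j ∈ Finset.range (initialDegree (lexIdeal K (c + 2) h)),
      configIdeal M L (c + 1) (t - j) (decomp K (c + 1) h j) ⊔
        Ideal.span {if Even (c + 2) then L (t - j + (c + 2 - 2) / 2)
          else M (t - j + (c + 2 - 1) / 2)}

/-- The index ranges `0 ≤ i_1 ≤ i_2 < i_3 ≤ i_4 < ...` bounded by `t + ⌊(c - 1) / 2⌋`; here
`i k` stands for `i_{k+1}`. -/
def IsAdmissible (c t : ℕ) (i : Fin c → ℕ) : Prop :=
  (∀ k, i k ≤ t + (c - 1) / 2) ∧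
  ∀ k l : Fin c, (l : ℕ) = k + 1 → if Even (k : ℕ) then i k ≤ i l else i k < i l

/-- The ideal of `Z_{c,t}`: the intersection of the ideals `(M_{i_1}, L_{i_2}, M_{i_3}, ...)` over all
`0 ≤ i_1 ≤ i_2 < i_3 ≤ i_4 < ... ≤ t + ⌊(c - 1) / 2⌋`. -/
noncomputable def maxConfigIdeal (M L : ℕ → MvPolynomial (Fin (n + 1)) K) (c t : ℕ) :
    Ideal (MvPolynomial (Fin (n + 1)) K) :=
  ⨅ (i : Fin c → ℕ) (_ : IsAdmissible c t i),
    Ideal.span (Set.range fun k : Fin c => if Even (k : ℕ) then M (i k) else L (i k))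

/-- The indices of the `2t + c` forms `M_0, ..., M_{t+⌊(c-1)/2⌋}, L_0, ..., L_{t+⌊(c-2)/2⌋}`
(where `⌊(c-2)/2⌋ = -1` for `c = 1`). -/
def formIndices (c t : ℕ) : Finset (ℕ ⊕ ℕ) :=
  (Finset.range (t + (c + 1) / 2)).disjSum (Finset.range (t + c / 2))

/-- Every set of at most `k` of these `2t + c` forms is linearly independent. -/
def InGeneralPosition (M L : ℕ → MvPolynomial (Fin (n + 1)) K) (c t k : ℕ) : Prop :=
  ∀ s ⊆ formIndices c t, s.card ≤ k → LinearIndepOn K (Sum.elim M L) (s : Set (ℕ ⊕ ℕ))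

/-! ### Subschemes of projective space, through their homogeneous ideals -/

/-- `I` is the saturated homogeneous ideal of a subscheme of `ℙⁿ`. -/
def IsSaturatedHomogeneous (I : Ideal (MvPolynomial (Fin (n + 1)) K)) : Prop :=
  (∀ f ∈ I, ∀ d, homogeneousComponent d f ∈ I) ∧
  ∀ f, (∀ i, X i * f ∈ I) → f ∈ I

/-- The subscheme of `ℙⁿ` defined by `I` has codimension `c`: the ring `R / I` has dimension
`n + 1 - c`. -/
def HasCodim (I : Ideal (MvPolynomial (Fin (n + 1)) K)) (c : ℕ) : Prop :=
  ringKrullDim (MvPolynomial (Fin (n + 1)) K ⧸ I) + (c : WithBot ℕ∞) = ((n + 1 : ℕ) : WithBot ℕ∞)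

/-- `R / I` is Cohen-Macaulay: there is an `R / I`-regular sequence in the irrelevant ideal whose
length is the dimension of `R / I`. -/
def IsACM (I : Ideal (MvPolynomial (Fin (n + 1)) K)) : Prop :=
  ∃ rs : List (MvPolynomial (Fin (n + 1)) K),
    (∀ r ∈ rs, r ∈ Ideal.span (Set.range (X : Fin (n + 1) → MvPolynomial (Fin (n + 1)) K))) ∧
    RingTheory.Sequence.IsRegular (MvPolynomial (Fin (n + 1)) K ⧸ I) rs ∧
    ((rs.length : ℕ) : WithBot ℕ∞) = ringKrullDim (MvPolynomial (Fin (n + 1)) K ⧸ I)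

/-- `h` is the `h`-vector of the Cohen-Macaulay ring `R / I` of dimension `D`: the Hilbert series of
`R / I` is `(∑ h_i z^i) / (1 - z)^D`, and `h` is the Hilbert function of every Artinian reduction of
`R / I`, that is, of every quotient by an `R / I`-regular sequence of `D` linear forms. (Such
sequences exist if `K` is infinite, but not always if `K` is finite.) -/
def IsHVector (I : Ideal (MvPolynomial (Fin (n + 1)) K)) (h : ℕ → ℕ) : Prop :=
  ∃ D : ℕ, ringKrullDim (MvPolynomial (Fin (n + 1)) K ⧸ I) = (D : WithBot ℕ∞) ∧
    (PowerSeries.mk fun d => (hilbertFn I d : ℤ)) * (1 - PowerSeries.X) ^ D =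
      PowerSeries.mk (fun i => (h i : ℤ)) ∧
    ∀ ls : List (MvPolynomial (Fin (n + 1)) K), ls.length = D → (∀ l ∈ ls, l.IsHomogeneous 1) →
      RingTheory.Sequence.IsRegular (MvPolynomial (Fin (n + 1)) K ⧸ I) ls →
      ∀ i, hilbertFn (I ⊔ Ideal.ofList ls) i = h i

/-- `I` defines a generalized stick figure: for some `d`, it is the radical ideal of a union of linear
subvarieties of dimension `d`, and any three different components meet in dimension at most `d - 2`
(the empty set having dimension `-1`). The dimension of a linear subvariety of `ℙⁿ` is one less than
the Krull dimension of its coordinate ring. -/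
def IsGeneralizedStickFigure (I : Ideal (MvPolynomial (Fin (n + 1)) K)) : Prop :=
  I.IsRadical ∧ ∃ d : ℕ,
    (∀ P ∈ I.minimalPrimes,
      (∃ s : Set (MvPolynomial (Fin (n + 1)) K),
        (∀ f ∈ s, f.IsHomogeneous 1) ∧ P = Ideal.span s) ∧
      ringKrullDim (MvPolynomial (Fin (n + 1)) K ⧸ P) = ((d + 1 : ℕ) : WithBot ℕ∞)) ∧
    ∀ P ∈ I.minimalPrimes, ∀ Q ∈ I.minimalPrimes, ∀ S ∈ I.minimalPrimes,
      P ≠ Q → P ≠ S → Q ≠ S →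
      ringKrullDim (MvPolynomial (Fin (n + 1)) K ⧸ (P ⊔ Q ⊔ S)) + 1 ≤ (d : WithBot ℕ∞)

end Ideals

end LexConfig

/-!
The ideal `I_{c,t}(h)` is an intersection of ideals generated by `c` of the linear forms, with one
component for each standard monomial of the Artinian lex-segment ideal `J` of `h`
(`configIdeal_eq_configInter`). If a standard monomial has the exponent `a`, with partial sums
`s_1, ..., s_c`, and `F_{r,u}` is `L_{u+(r-2)/2}` for even `r` and `M_{u+(r-1)/2}` for odd `r`,
then its component is generated by `F_{c,t-s_1}, F_{c-1,t-s_2}, ..., F_{1,t-s_c}`. The ideal `J`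
exists because `h` is an O-sequence: ranking the monomials of a degree lexicographically turns the
Macaulay bound into multiplication by the last variable (`macaulayBound_lexRank`), so the `h d`
smallest monomials of each degree `d` form the complement of a monomial ideal
(`IsLexHilbertFn.of_isOSequence`).

The set `A` of standard exponents is strongly stable, and this alone governs the ideal `I` of the
configuration. Let `ℓ = F_{c,t}`. The exponents in `A` beginning with `0` give the components which
contain `ℓ`, and the others give the components of the configuration of the shifted set with `t - 1`
in place of `t`. Strong stability and general position imply that `I : ℓ` is the ideal of the
shifted configuration (`mul_mem_configInter_iff`), and that `I + (ℓ)` is the ideal of the slice of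
`A` with `ℓ` added to each component (`configInter_sup_span`). The latter rests on
`configInter_eq_sup`: adding linear forms commutes with the intersection. Hence `R / I` is filtered
by the quotients by linear primes of codimension `c`, with one factor, shifted by the degree of `a`,
for each `a ∈ A` (`isFilteredBy_configInter`). The Hilbert series is therefore
`h(z) / (1 - z)^{n+1-c}`, the number of standard monomials of degree `d` being `h d`.

For the Cohen-Macaulay property over an arbitrary, possibly finite, field, it suffices to find a
sequence of `n + 1 - c` elements of the irrelevant ideal which is regular modulo each of the
finitely many linear primes, as it is then regular on `R / I` (`IsFilteredBy.isRegularMod`). It is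
constructed by prime avoidance, using that dividing by any nonzerodivisor lowers the depth by at
most one (`exists_common_isRegularMod`, `HasDepth.sup_span`).

For the stick figure property, order the forms as `M_0 < L_0 < M_1 < L_1 < ...`. In increasing
order, the forms generating a component alternate between the two families, beginning with an `M`.
A set of `c + 1` forms has at most two subsets of `c` forms with this property
(`not_isAlternating_erase`), so three different components involve at least `c + 2` forms
(`card_union_keys`), of which any `c + 2` are independent.

Finally, if `h' ≤ h`, then the standard monomials of the lex-segment ideal of `h'` are among those
of the ideal of `h` (`IsLexSegment.stdExps_subset`), and thus there are fewer components to
intersect.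
-/

namespace LexConfig

open MvPolynomial

/-! ### Ranks of monomials in the lexicographic order and the Macaulay bound -/

section

theorem degree_cons {c : ℕ} (j : ℕ) (a : Fin c →₀ ℕ) :
    (Finsupp.cons j a).degree = j + a.degree := by
  simp [Finsupp.degree_eq_sum, Fin.sum_univ_succ]

theorem degree_eq_zero_add_tail {c : ℕ} (a : Fin (c + 1) →₀ ℕ) :
    a.degree = a 0 + a.tail.degree := by
  conv_lhs => rw [← Finsupp.cons_tail a, degree_cons]

theorem tail_add_single_zero {c : ℕ} (a : Fin (c + 1) →₀ ℕ) (k : ℕ) :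
    (a + Finsupp.single 0 k).tail = a.tail := by
  ext i; simp [Finsupp.tail_apply]

theorem cons_add_single_zero {c : ℕ} (j k : ℕ) (a : Fin c →₀ ℕ) :
    Finsupp.cons j a + Finsupp.single 0 k = Finsupp.cons (j + k) a := by
  ext i; refine Fin.cases ?_ (fun i => ?_) i <;> simp

theorem cons_add_single_succ {c : ℕ} (j k : ℕ) (a : Fin c →₀ ℕ) (i : Fin c) :
    Finsupp.cons j a + Finsupp.single i.succ k = Finsupp.cons j (a + Finsupp.single i k) := by
  ext l; refine Fin.cases ?_ (fun l => ?_) l <;> simp [Finsupp.single_apply]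

/-- Induction on the first exponent. -/
@[elab_as_elim]
theorem expInduction {c : ℕ} {P : (Fin (c + 1) →₀ ℕ) → Prop}
    (cons_zero : ∀ a : Fin c →₀ ℕ, P (Finsupp.cons 0 a))
    (add_single : ∀ a, P a → P (a + Finsupp.single 0 1)) (a : Fin (c + 1) →₀ ℕ) : P a := by
  rw [← Finsupp.cons_tail a]
  induction a 0 with
  | zero => exact cons_zero _
  | succ k ih => have := add_single _ ih; rwa [cons_add_single_zero] at this

/-- The number of monomials of the same degree as the monomial with exponent `a` which are
lexicographically smaller. If `a` begins with `a_0` and the remaining exponents have degree `e`,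
then the summand for `l < a_0` counts the monomials with first exponent `a_0 - 1 - l`, whose
remaining exponents have degree `e + l + 1`. -/
noncomputable def lexRank : (c : ℕ) → (Fin c →₀ ℕ) → ℕ
  | 0, _ => 0
  | c + 1, a => ∑ l ∈ Finset.range (a 0), (c + a.tail.degree + l).choose (a.tail.degree + l + 1) +
      lexRank c a.tail

theorem lexRank_cons_zero {c : ℕ} (a : Fin c →₀ ℕ) :
    lexRank (c + 1) (Finsupp.cons 0 a) = lexRank c a := by
  simp [lexRank]

theorem lexRank_add_single {c : ℕ} (a : Fin (c + 1) →₀ ℕ) :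
    lexRank (c + 1) (a + Finsupp.single 0 1) =
      (c + a.degree).choose (a.degree + 1) + lexRank (c + 1) a := by
  rw [lexRank, lexRank, tail_add_single_zero, degree_eq_zero_add_tail a]
  simp only [Finsupp.coe_add, Pi.add_apply, Finsupp.single_eq_same, Finset.sum_range_succ]
  rw [show c + (a 0 + a.tail.degree) = c + a.tail.degree + a 0 by ring,
    show a 0 + a.tail.degree = a.tail.degree + a 0 by ring]
  ring

/-- The rank is less than the number of monomials of the same degree. -/
theorem lexRank_lt {c : ℕ} (a : Fin (c + 1) →₀ ℕ) :
    lexRank (c + 1) a < (c + a.degree).choose a.degree := by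
  induction c with
  | zero =>
    induction a using expInduction with
    | cons_zero a => simp [lexRank]
    | add_single a ih => simpa [lexRank_add_single] using ih
  | succ c ihc =>
    induction a using expInduction with
    | cons_zero a =>
      rw [lexRank_cons_zero, degree_cons, zero_add]
      exact (ihc a).trans_le (Nat.choose_le_choose _ (by omega))
    | add_single a ih =>
      rw [lexRank_add_single, map_add, Finsupp.degree_single, ← add_assoc (c + 1),
        Nat.choose_succ_succ, add_comm]
      gcongr

theorem macaulayBound_zero_right (i : ℕ) : macaulayBound i 0 = 0 := by
  cases i <;> simp [macaulayBound]

/-- If `k.choose (d + 1)` is the first term of the binomial expansion, its contribution to the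
Macaulay bound splits off. -/
theorem macaulayBound_choose_add {d k m : ℕ} (hk : d < k)
    (hm : k.choose (d + 1) + m < (k + 1).choose (d + 1)) :
    macaulayBound (d + 1) (k.choose (d + 1) + m) = (k + 1).choose (d + 2) + macaulayBound d m := by
  have hpos : 0 < k.choose (d + 1) := Nat.choose_pos hk
  -- The top index `k` of the binomial expansion lies in the range searched by `findGreatest`.
  have key : Nat.findGreatest (fun j => j.choose (d + 1) ≤ k.choose (d + 1) + m)
      (k.choose (d + 1) + m + d + 1) = k := by
    rw [Nat.findGreatest_eq_iff]
    refine ⟨?_, fun _ => Nat.le_add_right _ _, fun j hj _ => ?_⟩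
    · have : k - d ≤ k.choose (d + 1) := by
        obtain ⟨e, rfl⟩ : ∃ e, k = d + 1 + e := ⟨k - d - 1, by omega⟩
        clear hk hm hpos
        induction e with
        | zero => simp
        | succ e ih =>
          rw [← add_assoc, Nat.choose_succ_succ']
          have : 0 < (d + 1 + e).choose d := Nat.choose_pos (by omega)
          omega
      omega
    · have := Nat.choose_le_choose (d + 1) (show k + 1 ≤ j from hj)
      omega
  rw [macaulayBound, key]
  simp [hpos.ne']

/-- The recursion for `lexRank` computes the binomial expansion of the rank, so that the Macaulay
bound of the rank of a monomial is the rank of its product with the last variable. -/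
theorem macaulayBound_lexRank {c : ℕ} (a : Fin (c + 1) →₀ ℕ) :
    macaulayBound a.degree (lexRank (c + 1) a) =
      lexRank (c + 1) (a + Finsupp.single (Fin.last c) 1) := by
  induction c with
  | zero =>
    have h0 : ∀ a, lexRank 1 a = 0 := fun a => by
      induction a using expInduction with
      | cons_zero a => simp [lexRank]
      | add_single a ih => simpa [lexRank_add_single] using ih
    rw [h0, h0, macaulayBound_zero_right]
  | succ c ihc =>
    induction a using expInduction with
    | cons_zero a =>
      rw [← Fin.succ_last, cons_add_single_succ, lexRank_cons_zero, lexRank_cons_zero, degree_cons,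
        zero_add, ihc]
    | add_single a ih =>
      rw [add_right_comm a, lexRank_add_single, lexRank_add_single, ← ih, map_add, map_add,
        Finsupp.degree_single, Finsupp.degree_single]
      have := lexRank_lt a
      rw [macaulayBound_choose_add (by omega)]
      · congr 2
      · rw [add_comm, Nat.choose_succ_succ]
        gcongr

/-- Every number less than the number of monomials of degree `d` is the rank of one of them. -/
theorem exists_lexRank_eq {c : ℕ} {d m : ℕ} (hm : m < (c + d).choose d) :
    ∃ a : Fin (c + 1) →₀ ℕ, a.degree = d ∧ lexRank (c + 1) a = m := by
  induction c generalizing d m with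
  | zero =>
    refine ⟨Finsupp.cons d 0, by simp [degree_cons], ?_⟩
    have := lexRank_lt (Finsupp.cons d (0 : Fin 0 →₀ ℕ))
    simp at this hm
    rw [this, hm]
  | succ c ihc =>
    induction d generalizing m with
    | zero =>
      obtain ⟨a, ha, ha'⟩ := @ihc 0 m (by simpa using hm)
      exact ⟨Finsupp.cons 0 a, by simp [degree_cons, ha], by rw [lexRank_cons_zero, ha']⟩
    | succ d ih =>
      by_cases h : m < (c + (d + 1)).choose (d + 1)
      · obtain ⟨a, ha, ha'⟩ := ihc h
        exact ⟨Finsupp.cons 0 a, by simp [degree_cons, ha], by rw [lexRank_cons_zero, ha']⟩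
      · have : m - (c + (d + 1)).choose (d + 1) < (c + 1 + d).choose d := by
          rw [← add_assoc, Nat.choose_succ_succ'] at hm
          rw [show c + 1 + d = c + (d + 1) by ring] at *
          omega
        obtain ⟨a, ha, ha'⟩ := ih this
        refine ⟨a + Finsupp.single 0 1, by simp [ha], ?_⟩
        rw [lexRank_add_single, ha, ha', show c + 1 + d = c + (d + 1) by ring]
        omega

theorem toDegLex_lt_iff {c : ℕ} {a b : Fin (c + 1) →₀ ℕ} (h : a.degree = b.degree) :
    toDegLex a < toDegLex b ↔ a 0 < b 0 ∨ a 0 = b 0 ∧ toDegLex a.tail < toDegLex b.tail := by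
  have key : ∀ {c : ℕ} {a b : Fin c →₀ ℕ}, a.degree = b.degree →
      (toDegLex a < toDegLex b ↔ ∃ i, (∀ j < i, a j = b j) ∧ a i < b i) := by
    intro c a b h
    rw [Finsupp.DegLex.lt_iff]
    simp only [ofDegLex_toDegLex, h, lt_irrefl, false_or, true_and]
    rfl
  rw [key h]
  constructor
  · rintro ⟨i, hi, hlt⟩
    induction i using Fin.cases with
    | zero => exact Or.inl hlt
    | succ i =>
      have h0 := hi 0 (Fin.succ_pos i)
      refine Or.inr ⟨h0, (key ?_).2 ⟨i, fun j hj => hi j.succ (by simpa using hj), hlt⟩⟩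
      rw [degree_eq_zero_add_tail, degree_eq_zero_add_tail b] at h
      omega
  · rintro (hlt | ⟨h0, hlt⟩)
    · exact ⟨0, by simp, hlt⟩
    · rw [key] at hlt
      · obtain ⟨i, hi, hlt⟩ := hlt
        refine ⟨i.succ, fun j hj => ?_, hlt⟩
        induction j using Fin.cases with
        | zero => exact h0
        | succ j => exact hi j (by simpa using hj)
      · rw [degree_eq_zero_add_tail, degree_eq_zero_add_tail b] at h
        omega

theorem lexRank_strictMono {c : ℕ} {a b : Fin c →₀ ℕ} (h : a.degree = b.degree)
    (hab : toDegLex a < toDegLex b) : lexRank c a < lexRank c b := by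
  induction c with
  | zero => rw [Subsingleton.elim a b] at hab; exact absurd hab (lt_irrefl _)
  | succ c ihc =>
    induction a using expInduction generalizing b with
    | cons_zero a =>
      rw [lexRank_cons_zero]
      induction b using expInduction with
      | cons_zero b =>
        rw [lexRank_cons_zero]
        rw [toDegLex_lt_iff h] at hab
        simp only [Finsupp.cons_zero, lt_irrefl, false_or, Finsupp.tail_cons, true_and] at hab
        exact ihc (by simpa [degree_cons] using h) hab
      | add_single b _ =>
        rw [lexRank_add_single]
        rw [degree_cons, map_add, Finsupp.degree_single, zero_add] at h
        cases c with
        | zero =>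
          rw [Subsingleton.elim a 0] at h; simp at h
        | succ c =>
          have := lexRank_lt a
          rw [h] at this
          rw [show c + 1 + b.degree = c + (b.degree + 1) by ring]
          omega
    | add_single a ih =>
      induction b using expInduction with
      | cons_zero b =>
        rw [toDegLex_lt_iff h] at hab
        simp at hab
      | add_single b _ =>
        rw [lexRank_add_single, lexRank_add_single]
        have h' : a.degree = b.degree := by simpa using h
        rw [h']
        refine Nat.add_lt_add_left (ih h' ?_) _
        rw [toDegLex_lt_iff h] at hab
        rw [toDegLex_lt_iff h']
        simpa [tail_add_single_zero] using hab

theorem lexRank_le_iff {c : ℕ} {a b : Fin c →₀ ℕ} (h : a.degree = b.degree) :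
    lexRank c a ≤ lexRank c b ↔ toDegLex a ≤ toDegLex b := by
  constructor
  · intro hab
    by_contra hlt
    exact absurd (lexRank_strictMono h.symm (not_le.1 hlt)) (by omega)
  · intro hab
    rcases hab.lt_or_eq with hlt | heq
    · exact (lexRank_strictMono h hlt).le
    · rw [toDegLex_injective heq]

end

/-! ### Lex-segment ideals with a given Hilbert function -/

section

/-- An O-sequence with `h 1 ≤ c + 1` is bounded by the Hilbert function of the polynomial ring in
`c + 1` variables, so that the smallest `h d` monomials of degree `d` exist. -/
theorem le_choose_of_isOSequence {c : ℕ} {h : ℕ → ℕ} (hO : IsOSequence h) (hc : h 1 ≤ c + 1)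
    (d : ℕ) :
    h d ≤ (c + d).choose d := by
  induction d with
  | zero => simp [hO.1]
  | succ d ih =>
    rcases Nat.eq_zero_or_pos d with rfl | hd
    · simpa using hc
    refine (hO.2 d hd).trans ?_
    rcases ih.lt_or_eq with hlt | heq
    · obtain ⟨a, ha, ha'⟩ := exists_lexRank_eq hlt
      have := lexRank_lt (a + Finsupp.single (Fin.last c) 1)
      rw [← ha', ← ha, macaulayBound_lexRank]
      rw [map_add, Finsupp.degree_single] at this
      exact this.le
    · obtain ⟨d, rfl⟩ : ∃ e, d = e + 1 := ⟨d - 1, by omega⟩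
      have h1 := @macaulayBound_choose_add d (c + (d + 1)) 0 (by omega) (by
        rw [Nat.choose_succ_succ']
        have : 0 < (c + (d + 1)).choose d := Nat.choose_pos (by omega)
        omega)
      rw [add_zero, macaulayBound_zero_right, add_zero] at h1
      rw [heq, h1]
      rfl

/-- The exponents of the `h d` lexicographically smallest monomials of degree `d`, for all `d`. -/
def lexSet (c : ℕ) (h : ℕ → ℕ) : Set (Fin c →₀ ℕ) := {a | lexRank c a < h a.degree}

theorem mem_lexSet {c : ℕ} {h : ℕ → ℕ} {a : Fin c →₀ ℕ} :
    a ∈ lexSet c h ↔ lexRank c a < h a.degree := Iff.rfl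

theorem lexRank_zero (c : ℕ) : lexRank c 0 = 0 := by
  induction c with
  | zero => rfl
  | succ c ih => rw [← Finsupp.cons_zero_zero, lexRank_cons_zero, ih]

/-- Macaulay's condition makes the complement of `lexSet` closed under multiplication by variables:
if the monomial of rank `h d` times the last variable has rank at least `h (d + 1)`, then so does
every larger monomial times any variable. -/
theorem mem_lexSet_of_add_single {c : ℕ} {h : ℕ → ℕ} (hO : IsOSequence h)
    {a : Fin (c + 1) →₀ ℕ} {i : Fin (c + 1)} (ha : a + Finsupp.single i 1 ∈ lexSet (c + 1) h) :
    a ∈ lexSet (c + 1) h := by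
  rw [mem_lexSet] at ha ⊢
  rw [map_add, Finsupp.degree_single] at ha
  rcases Nat.eq_zero_or_pos a.degree with h0 | hd
  · rw [h0, hO.1, (Finsupp.degree_eq_zero_iff a).1 h0, lexRank_zero]; exact one_pos
  by_contra hlt
  have h1 := hO.2 _ hd
  -- The monomial `b` of rank `h d` is at most `a`, so `b` times the last variable is at most the
  -- monomial of `a + single i 1`.
  obtain ⟨b, hb, hb'⟩ := exists_lexRank_eq ((not_lt.1 hlt).trans_lt (lexRank_lt a))
  rw [← hb', ← hb, macaulayBound_lexRank, hb] at h1
  have h2 : toDegLex (b + Finsupp.single (Fin.last c) 1) ≤ toDegLex (a + Finsupp.single i 1) := by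
    rw [toDegLex_add, toDegLex_add]
    refine add_le_add ((lexRank_le_iff hb).1 (by omega)) ?_
    exact Finsupp.DegLex.single_antitone (Fin.le_last i)
  rw [← lexRank_le_iff (by simp [hb])] at h2
  omega

theorem mem_lexSet_of_le {c : ℕ} {h : ℕ → ℕ} (hO : IsOSequence h)
    {a b : Fin (c + 1) →₀ ℕ} (ha : a ∈ lexSet (c + 1) h) (hba : b ≤ a) : b ∈ lexSet (c + 1) h := by
  obtain ⟨e, rfl⟩ := exists_add_of_le hba
  clear hba
  induction e using Finsupp.induction_linear generalizing b with
  | zero => simpa using ha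
  | add f g hf hg => rw [← add_assoc] at ha; exact hf (hg ha)
  | single i k =>
    induction k with
    | zero => simpa using ha
    | succ k ihk =>
      rw [Finsupp.single_add, ← add_assoc] at ha
      exact ihk (mem_lexSet_of_add_single hO ha)

theorem ncard_lexSet {c : ℕ} {h : ℕ → ℕ} (hO : IsOSequence h) (hc : h 1 ≤ c + 1) (d : ℕ) :
    {a ∈ lexSet (c + 1) h | a.degree = d}.ncard = h d := by
  have h1 : Set.BijOn (lexRank (c + 1)) {a ∈ lexSet (c + 1) h | a.degree = d} (Set.Iio (h d)) := by
    refine ⟨fun a ha => ?_, fun a ha b hb hab => ?_, fun m hm => ?_⟩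
    · have := ha.1; rw [mem_lexSet, ha.2] at this; exact this
    · have hd : a.degree = b.degree := ha.2.trans hb.2.symm
      exact toDegLex_injective (le_antisymm ((lexRank_le_iff hd).1 hab.le)
        ((lexRank_le_iff hd.symm).1 hab.ge))
    · obtain ⟨a, ha, ha'⟩ := exists_lexRank_eq
        (lt_of_lt_of_le hm (le_choose_of_isOSequence hO hc d))
      exact ⟨a, ⟨by rw [mem_lexSet, ha, ha']; exact hm, ha⟩, ha'⟩
  rw [h1.ncard_eq, ← Finset.coe_Iio, Set.ncard_coe_finset, Nat.card_Iio]

section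
variable {K : Type*} [Field K]

/-- The exponents of the monomials outside of `J`. -/
def stdExps {c : ℕ} (J : Ideal (MvPolynomial (Fin c) K)) : Set (Fin c →₀ ℕ) :=
  {a | monomial a (1 : K) ∉ J}

/-- Monomial ideals: with a polynomial, the ideal contains the monomials of its support. -/
def IsMonomial {c : ℕ} (J : Ideal (MvPolynomial (Fin c) K)) : Prop :=
  ∀ f ∈ J, ∀ m ∈ f.support, monomial m (1 : K) ∈ J

theorem monomial_mem {c : ℕ} {J : Ideal (MvPolynomial (Fin c) K)} {m : Fin c →₀ ℕ}
    (hm : monomial m (1 : K) ∈ J) (r : K) : monomial m r ∈ J := by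
  have := J.mul_mem_left (C r) hm
  rwa [C_mul_monomial, mul_one] at this

theorem monomial_mem_of_le {c : ℕ} {J : Ideal (MvPolynomial (Fin c) K)} {m m' : Fin c →₀ ℕ}
    (hm : monomial m (1 : K) ∈ J) (h : m ≤ m') : monomial m' (1 : K) ∈ J := by
  obtain ⟨e, rfl⟩ := exists_add_of_le h
  have := J.mul_mem_left (monomial e 1) hm
  rwa [monomial_mul, mul_one, add_comm] at this

theorem isMonomial_iff {c : ℕ} {J : Ideal (MvPolynomial (Fin c) K)} :
    IsMonomial J ↔ ∃ S : Set (Fin c →₀ ℕ), J = Ideal.span ((fun m => monomial m (1 : K)) '' S) := by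
  constructor
  · intro h
    refine ⟨{m | monomial m (1 : K) ∈ J}, le_antisymm (fun f hf => ?_) ?_⟩
    · rw [mem_ideal_span_monomial_image]
      exact fun m hm => ⟨m, h f hf m hm, le_rfl⟩
    · rw [Ideal.span_le]
      rintro _ ⟨m, hm, rfl⟩
      exact hm
  · rintro ⟨S, rfl⟩ f hf m hm
    rw [mem_ideal_span_monomial_image] at hf
    obtain ⟨s, hs, hsm⟩ := hf m hm
    exact monomial_mem_of_le (Ideal.subset_span ⟨s, hs, rfl⟩) hsm

theorem finite_degree_eq (c d : ℕ) : {a : Fin c →₀ ℕ | a.degree = d}.Finite := by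
  refine (Set.finite_Iic (Finsupp.equivFunOnFinite.symm fun _ : Fin c => d)).subset fun a ha i => ?_
  rw [← show a.degree = d from ha]
  exact Finsupp.le_degree i a

/-- The standard monomials of degree `d` form a basis of the degree `d` part of the quotient. -/
theorem hilbertFn_eq_ncard {c : ℕ} {J : Ideal (MvPolynomial (Fin c) K)} (hJ : IsMonomial J)
    (d : ℕ) :
    hilbertFn J d = {a ∈ stdExps J | a.degree = d}.ncard := by
  set s := {a ∈ stdExps J | a.degree = d}
  have hfin : s.Finite := (finite_degree_eq c d).subset fun a ha => ha.2
  have : Fintype s := hfin.fintype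
  let v : s → MvPolynomial (Fin c) K ⧸ J := fun a => Ideal.Quotient.mkₐ K J (monomial a.1 1)
  have hv : LinearIndependent K v := by
    rw [Fintype.linearIndependent_iff]
    intro g hg a
    have h1 : ∑ i : s, monomial i.1 (g i) ∈ J := by
      rw [← Ideal.Quotient.eq_zero_iff_mem, ← Ideal.Quotient.mkₐ_eq_mk K, map_sum, ← hg]
      refine Finset.sum_congr rfl fun i _ => ?_
      rw [← map_smul, smul_monomial, smul_eq_mul, mul_one]
    by_contra hne
    refine a.2.1 (hJ _ h1 a.1 ?_)
    rw [mem_support_iff, coeff_sum, Finset.sum_eq_single a]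
    · simpa using hne
    · intro b _ hb
      rw [coeff_monomial, if_neg fun h => hb (Subtype.ext h)]
    · simp
  have hspan : (homogeneousSubmodule (Fin c) K d).map (Ideal.Quotient.mkₐ K J).toLinearMap =
      Submodule.span K (Set.range v) := by
    apply le_antisymm
    · rintro _ ⟨f, hf, rfl⟩
      change Ideal.Quotient.mkₐ K J f ∈ _
      rw [f.as_sum, map_sum]
      refine Submodule.sum_mem _ fun m hm => ?_
      by_cases hmJ : monomial m (1 : K) ∈ J
      · have := monomial_mem hmJ (coeff m f)
        rw [← Ideal.Quotient.eq_zero_iff_mem] at this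
        rw [Ideal.Quotient.mkₐ_eq_mk, this]
        exact Submodule.zero_mem _
      · have hd : m.degree = d := by
          rw [Finsupp.degree_eq_weight_one]
          exact hf (mem_support_iff.1 hm)
        rw [show monomial m (coeff m f) = coeff m f • monomial m (1 : K) by
          rw [smul_monomial, smul_eq_mul, mul_one], map_smul]
        exact Submodule.smul_mem _ _ (Submodule.subset_span ⟨⟨m, hmJ, hd⟩, rfl⟩)
    · rw [Submodule.span_le]
      rintro _ ⟨a, rfl⟩
      exact ⟨_, isHomogeneous_monomial _ a.2.2, rfl⟩
  rw [hilbertFn, hspan, finrank_span_eq_card hv, ← Nat.card_eq_fintype_card, Nat.card_coe_set_eq]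

theorem isArtinianRing_of_finite {c : ℕ} {J : Ideal (MvPolynomial (Fin c) K)}
    (hfin : (stdExps J).Finite) : IsArtinianRing (MvPolynomial (Fin c) K ⧸ J) := by
  classical
  have : Module.Finite K (MvPolynomial (Fin c) K ⧸ J) := by
    refine ⟨⟨hfin.toFinset.image fun a => Ideal.Quotient.mkₐ K J (monomial a 1), ?_⟩⟩
    rw [eq_top_iff]
    rintro x -
    obtain ⟨f, rfl⟩ := Ideal.Quotient.mkₐ_surjective K J x
    rw [f.as_sum, map_sum]
    refine Submodule.sum_mem _ fun m hm => ?_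
    by_cases hmJ : monomial m (1 : K) ∈ J
    · have := monomial_mem hmJ (coeff m f)
      rw [← Ideal.Quotient.eq_zero_iff_mem] at this
      rw [Ideal.Quotient.mkₐ_eq_mk, this]
      exact Submodule.zero_mem _
    · rw [show monomial m (coeff m f) = coeff m f • monomial m (1 : K) by
          rw [smul_monomial, smul_eq_mul, mul_one], map_smul]
      exact Submodule.smul_mem _ _ (Submodule.subset_span (by
        simpa using ⟨m, hmJ, rfl⟩))
  exact IsArtinianRing.of_finite K _

theorem IsLexSegment.isMonomial {c : ℕ} {J : Ideal (MvPolynomial (Fin c) K)} (hJ : IsLexSegment J) :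
    IsMonomial J := isMonomial_iff.2 hJ.1

/-- In each degree, the standard monomials of a lex-segment ideal are an initial segment, so
inclusion is decided by comparing cardinalities. -/
theorem IsLexSegment.stdExps_subset {c : ℕ} {J J' : Ideal (MvPolynomial (Fin c) K)}
    (hJ : IsLexSegment J) (hJ' : IsLexSegment J') (h : ∀ d, hilbertFn J d ≤ hilbertFn J' d) :
    stdExps J ⊆ stdExps J' := by
  intro a ha
  by_contra ha'
  have h1 := h a.degree
  rw [hilbertFn_eq_ncard hJ.isMonomial, hilbertFn_eq_ncard hJ'.isMonomial] at h1
  refine absurd (Set.ncard_lt_ncard (t := {b ∈ stdExps J | b.degree = a.degree})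
    (s := {b ∈ stdExps J' | b.degree = a.degree}) ?_
    ((finite_degree_eq c a.degree).subset fun _ hb => hb.2)) (by omega)
  have hlt : ∀ b ∈ stdExps J', b.degree = a.degree → toDegLex b < toDegLex a := by
    intro b hb hd
    by_contra hlt
    rcases (not_lt.1 hlt).lt_or_eq with h2 | h2
    · exact hb (hJ'.2 b a hd h2 (not_not.1 ha'))
    · exact ha' (toDegLex_injective h2 ▸ hb)
  rw [Set.ssubset_iff_of_subset]
  · exact ⟨a, ⟨ha, rfl⟩, fun h2 => ha' h2.1⟩
  · rintro b ⟨hb, hd⟩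
    exact ⟨fun hbJ => ha (hJ.2 a b hd.symm (hlt b hb hd) hbJ), hd⟩

theorem IsLexSegment.le_of_hilbertFn_le {c : ℕ} {J J' : Ideal (MvPolynomial (Fin c) K)}
    (hJ : IsLexSegment J) (hJ' : IsLexSegment J') (h : ∀ d, hilbertFn J d ≤ hilbertFn J' d) :
    J' ≤ J := by
  intro f hf
  rw [f.as_sum]
  refine Ideal.sum_mem _ fun m hm => monomial_mem ?_ _
  by_contra hmJ
  exact hJ.stdExps_subset hJ' h hmJ (hJ'.isMonomial f hf m hm)

theorem IsLexSegment.eq_of_hilbertFn_eq {c : ℕ} {J J' : Ideal (MvPolynomial (Fin c) K)}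
    (hJ : IsLexSegment J) (hJ' : IsLexSegment J') (h : ∀ d, hilbertFn J d = hilbertFn J' d) :
    J = J' :=
  le_antisymm (hJ'.le_of_hilbertFn_le hJ fun d => (h d).ge)
      (hJ.le_of_hilbertFn_le hJ' fun d => (h d).le)

variable (K) in
/-- There is an Artinian lex-segment ideal in `c` variables with Hilbert function `h`. -/
def IsLexHilbertFn (c : ℕ) (h : ℕ → ℕ) : Prop :=
  ∃ J : Ideal (MvPolynomial (Fin c) K), IsLexSegment J ∧
    IsArtinianRing (MvPolynomial (Fin c) K ⧸ J) ∧ ∀ d, hilbertFn J d = h d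

theorem IsLexHilbertFn.lexIdeal_spec {c : ℕ} {h : ℕ → ℕ} (H : IsLexHilbertFn K c h) :
    IsLexSegment (lexIdeal K c h) ∧ IsArtinianRing (MvPolynomial (Fin c) K ⧸ lexIdeal K c h) ∧
      ∀ d, hilbertFn (lexIdeal K c h) d = h d :=
  Classical.epsilon_spec H

theorem IsLexHilbertFn.of_isOSequence {c v : ℕ} {h : ℕ → ℕ} (hO : IsOSequence h) (hc : h 1 ≤ c + 1)
    (hv : ∀ i, v < i → h i = 0) : IsLexHilbertFn K (c + 1) h := by
  set J : Ideal (MvPolynomial (Fin (c + 1)) K) :=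
    Ideal.span ((fun m => monomial m (1 : K)) '' (lexSet (c + 1) h)ᶜ)
  have hmem : ∀ m, monomial m (1 : K) ∈ J ↔ m ∉ lexSet (c + 1) h := by
    intro m
    constructor
    · intro hm hmem
      rw [mem_ideal_span_monomial_image] at hm
      obtain ⟨s, hs, hsm⟩ := hm m (by simp)
      exact hs (mem_lexSet_of_le hO hmem hsm)
    · intro hm
      exact Ideal.subset_span ⟨m, hm, rfl⟩
  have hstd : stdExps J = lexSet (c + 1) h := by
    ext m; simp [stdExps, hmem]
  have hmon : IsMonomial J := isMonomial_iff.2 ⟨_, rfl⟩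
  refine ⟨J, ⟨⟨_, rfl⟩, fun m₁ m₂ hd hlt h2 => ?_⟩, ?_, fun d => ?_⟩
  · rw [hmem] at h2 ⊢
    intro h1
    have := lexRank_strictMono hd.symm hlt
    refine h2 (this.trans ?_)
    have h3 := mem_lexSet.1 h1
    rwa [hd] at h3
  · apply isArtinianRing_of_finite
    rw [hstd]
    refine ((Set.finite_Iic v).biUnion fun d _ => finite_degree_eq (c + 1) d).subset fun a ha => ?_
    simp only [Set.mem_iUnion]
    refine ⟨a.degree, ?_, rfl⟩
    by_contra hlt
    have h3 := mem_lexSet.1 ha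
    rw [hv _ (not_le.1 hlt)] at h3
    omega
  · rw [hilbertFn_eq_ncard hmon, hstd, ncard_lexSet hO hc]

end

end

/-! ### Strongly stable sets of exponents and slices of lex-segment ideals -/

section

/-- Sets of exponents which are closed under passing to divisors and under replacing a variable by a
later one. They are the complements of strongly stable monomial ideals. -/
structure IsStronglyStable {c : ℕ} (A : Set (Fin c →₀ ℕ)) : Prop where
  mem_of_le : ∀ {a b}, a ∈ A → b ≤ a → b ∈ A
  mem_of_lt : ∀ {a i j}, a + Finsupp.single i 1 ∈ A → i < j → a + Finsupp.single j 1 ∈ A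

/-- Exponents `a` such that `(j, a) ∈ A`. -/
def sliceSet {c : ℕ} (A : Set (Fin (c + 1) →₀ ℕ)) (j : ℕ) : Set (Fin c →₀ ℕ) :=
  {a | Finsupp.cons j a ∈ A}

/-- The exponents of the monomials whose product with the first variable has its exponent in `A`. -/
def shiftSet {c : ℕ} (A : Set (Fin (c + 1) →₀ ℕ)) : Set (Fin (c + 1) →₀ ℕ) :=
  {a | a + Finsupp.single 0 1 ∈ A}

theorem IsStronglyStable.sliceSet {c : ℕ} {A : Set (Fin (c + 1) →₀ ℕ)} (hA : IsStronglyStable A)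
    (j : ℕ) : IsStronglyStable (sliceSet A j) where
  mem_of_le {a b} ha hba := hA.mem_of_le ha fun i => by
    induction i using Fin.cases with
    | zero => simp
    | succ i => simpa using hba i
  mem_of_lt {a i k} ha hik := by
    have := hA.mem_of_lt (a := Finsupp.cons j a) (i := i.succ) (j := k.succ)
    rw [cons_add_single_succ, cons_add_single_succ] at this
    exact this ha (by simpa using hik)

theorem IsStronglyStable.shiftSet {c : ℕ} {A : Set (Fin (c + 1) →₀ ℕ)} (hA : IsStronglyStable A) :
    IsStronglyStable (shiftSet A) where
  mem_of_le {a b} ha hba := hA.mem_of_le ha (by gcongr)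
  mem_of_lt {a i k} ha hik := by
    have := hA.mem_of_lt (a := a + Finsupp.single 0 1) (i := i) (j := k)
    rw [add_right_comm a _ (Finsupp.single i 1), add_right_comm a _ (Finsupp.single k 1)] at this
    exact this ha hik

section
variable {K : Type*} [Field K]

theorem IsLexSegment.isStronglyStable {c : ℕ} {J : Ideal (MvPolynomial (Fin c) K)}
    (hJ : IsLexSegment J) : IsStronglyStable (stdExps J) where
  mem_of_le ha hba hb := ha (monomial_mem_of_le hb hba)
  mem_of_lt {a i j} ha hij hb := by
    refine ha (hJ.2 _ _ (by simp) ?_ hb)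
    rw [toDegLex_add, toDegLex_add]
    exact add_lt_add_right (Finsupp.DegLex.single_strictAnti hij) _

theorem X_pow_mul_rename_monomial {c : ℕ} (j : ℕ) (m : Fin c →₀ ℕ) (r : K) :
    (X 0 ^ j * rename Fin.succ (monomial m r) : MvPolynomial (Fin (c + 1)) K) =
      monomial (Finsupp.cons j m) r := by
  rw [rename_monomial, X_pow_eq_monomial, monomial_mul, one_mul]
  refine congrArg (fun s => monomial s r) (Finsupp.ext fun i => ?_)
  induction i using Fin.cases with
  | zero =>
    rw [Finsupp.add_apply, Finsupp.mapDomain_of_notMem_range _ _ (by simp)]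
    simp
  | succ i =>
    rw [Finsupp.add_apply, Finsupp.mapDomain_apply (Fin.succ_injective _)]
    simp

theorem coeff_X_pow_mul_rename {c : ℕ} (j : ℕ) (m : Fin c →₀ ℕ) (f : MvPolynomial (Fin c) K) :
    coeff (Finsupp.cons j m) (X 0 ^ j * rename Fin.succ f : MvPolynomial (Fin (c + 1)) K) =
      coeff m f := by
  classical
  induction f using MvPolynomial.induction_on' with
  | monomial u a =>
    rw [X_pow_mul_rename_monomial, coeff_monomial, coeff_monomial]
    simp [Finsupp.cons_injective2.eq_iff]
  | add p q hp hq => rw [map_add, mul_add, coeff_add, coeff_add, hp, hq]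

theorem monomial_mem_slice {c : ℕ} {J : Ideal (MvPolynomial (Fin (c + 1)) K)} {j : ℕ}
    {m : Fin c →₀ ℕ} {r : K} :
    monomial m r ∈ slice J j ↔ monomial (Finsupp.cons j m) r ∈ J := by
  rw [← X_pow_mul_rename_monomial]
  rfl

theorem stdExps_slice {c : ℕ} (J : Ideal (MvPolynomial (Fin (c + 1)) K)) (j : ℕ) :
    stdExps (slice J j) = sliceSet (stdExps J) j := by
  ext m
  simp [stdExps, sliceSet, monomial_mem_slice]

theorem IsLexSegment.slice {c : ℕ} {J : Ideal (MvPolynomial (Fin (c + 1)) K)}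
    (hJ : IsLexSegment J) (j : ℕ) : IsLexSegment (slice J j) := by
  refine ⟨isMonomial_iff.1 fun f hf m hm => ?_, fun m₁ m₂ hd hlt h2 => ?_⟩
  · rw [monomial_mem_slice]
    refine hJ.isMonomial _ hf _ ?_
    rw [mem_support_iff, coeff_X_pow_mul_rename]
    exact mem_support_iff.1 hm
  · rw [monomial_mem_slice] at h2 ⊢
    have hd' : (Finsupp.cons j m₂).degree = (Finsupp.cons j m₁).degree := by
      rw [degree_cons, degree_cons, hd]
    refine hJ.2 _ _ hd'.symm ?_ h2
    rw [toDegLex_lt_iff hd']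
    simpa using hlt

theorem IsLexSegment.degree_le_of_mem_stdExps {c v : ℕ} {J : Ideal (MvPolynomial (Fin c) K)}
    (hJ : IsLexSegment J) (hv : ∀ i, v < i → hilbertFn J i = 0) {a : Fin c →₀ ℕ}
    (ha : a ∈ stdExps J) : a.degree ≤ v := by
  by_contra hlt
  have h1 := hv _ (not_le.1 hlt)
  rw [hilbertFn_eq_ncard hJ.isMonomial,
    Set.ncard_eq_zero ((finite_degree_eq c a.degree).subset fun _ hb => hb.2)] at h1
  have : a ∈ ({b ∈ stdExps J | b.degree = a.degree} : Set _) := ⟨ha, rfl⟩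
  rw [h1] at this
  exact this

theorem finite_of_degree_le {c v : ℕ} {A : Set (Fin c →₀ ℕ)} (h : ∀ a ∈ A, a.degree ≤ v) :
    A.Finite :=
  ((Set.finite_Iic v).biUnion fun d _ => finite_degree_eq c d).subset fun a ha => by
    simp only [Set.mem_iUnion]
    exact ⟨a.degree, h a ha, rfl⟩

/-- The slices of the lex-segment ideal of `h` are the lex-segment ideals of the sequences in the
decomposition of `h`. -/
theorem lexIdeal_decomp {c v : ℕ} {h : ℕ → ℕ} (H : IsLexHilbertFn K (c + 1) h)
    (hv : ∀ a ∈ stdExps (lexIdeal K (c + 1) h), a.degree ≤ v) (j : ℕ) :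
    IsLexHilbertFn K c (decomp K c h j) ∧
      lexIdeal K c (decomp K c h j) = slice (lexIdeal K (c + 1) h) j := by
  obtain ⟨hlex, -, -⟩ := H.lexIdeal_spec
  have hfin : (stdExps (slice (lexIdeal K (c + 1) h) j)).Finite := by
    refine finite_of_degree_le (v := v) fun a ha => ?_
    rw [stdExps_slice] at ha
    have := hv _ ha
    rw [degree_cons] at this
    omega
  have h1 : IsLexHilbertFn K c (decomp K c h j) :=
    ⟨_, hlex.slice j, isArtinianRing_of_finite hfin, fun _ => rfl⟩
  exact ⟨h1, h1.lexIdeal_spec.1.eq_of_hilbertFn_eq (hlex.slice j) h1.lexIdeal_spec.2.2⟩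

/-- The initial degree is the number of nonempty slices: in the lowest degree in which a lex-segment
ideal is nonzero, it contains the power of the first variable. -/
theorem lt_initialDegree_iff {c v : ℕ} {J : Ideal (MvPolynomial (Fin (c + 1)) K)}
    (hJ : IsLexSegment J) (hv : ∀ a ∈ stdExps J, a.degree ≤ v) (j : ℕ) :
    j < initialDegree J ↔ (sliceSet (stdExps J) j).Nonempty := by
  have h0 : (sliceSet (stdExps J) j).Nonempty ↔ Finsupp.single 0 j ∈ stdExps J := by
    constructor
    · rintro ⟨a, ha⟩
      refine hJ.isStronglyStable.mem_of_le ha ?_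
      rw [← Finsupp.cons_zero_eq_single_zero]
      intro i
      induction i using Fin.cases <;> simp
    · intro h
      refine ⟨0, ?_⟩
      rw [← Finsupp.cons_zero_eq_single_zero] at h
      exact h
  rw [h0, ← not_iff_not, not_lt]
  change _ ↔ ¬ ¬ _
  rw [not_not]
  have hmem : ∀ k, monomial (Finsupp.single 0 k) (1 : K) ∈ J → initialDegree J ≤ k := fun k hk =>
    Nat.sInf_le ⟨_, hk, by simp, isHomogeneous_monomial _ (by simp)⟩
  refine ⟨fun hle => ?_, hmem j⟩
  -- The infimum defining `initialDegree` is attained, since `J` contains a power of `X 0`.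
  have hne : {d | ∃ f ∈ J, f ≠ 0 ∧ f.IsHomogeneous d}.Nonempty := by
    refine ⟨v + 1, monomial (Finsupp.single 0 (v + 1)) 1, ?_, by simp,
        isHomogeneous_monomial _ (by simp)⟩
    by_contra hmem
    have := hv _ hmem
    simp at this
  obtain ⟨f, hf, hf0, hfd⟩ := Nat.sInf_mem hne
  obtain ⟨m, hm⟩ := support_nonempty.2 hf0
  have hmJ := hJ.isMonomial f hf m hm
  have hd : m.degree = initialDegree J := by
    rw [Finsupp.degree_eq_weight_one]
    exact hfd (mem_support_iff.1 hm)
  refine monomial_mem_of_le (m := Finsupp.single 0 m.degree) ?_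
      (Finsupp.single_mono (hd.le.trans hle))
  rcases eq_or_ne m (Finsupp.single 0 m.degree) with heq | hne
  · rwa [← heq]
  refine hJ.2 _ m (by simp) ?_ hmJ
  rw [toDegLex_lt_iff (by simp)]
  left
  rw [Finsupp.single_eq_same]
  refine lt_of_le_of_ne (Finsupp.le_degree 0 m) fun h => hne ?_
  have h1 := degree_eq_zero_add_tail m
  have h2 : m.tail = 0 := (Finsupp.degree_eq_zero_iff _).1 (by omega)
  rw [← h, ← Finsupp.cons_zero_eq_single_zero, ← h2, Finsupp.cons_tail]

end

end

/-! ### Intersections of ideals generated by linear forms -/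

section

/-- The index of the linear form adjoined at codimension `r` with parameter `u`: it is `L` with
index `u + (r - 2) / 2` if `r` is even, and `M` with index `u + (r - 1) / 2` if `r` is odd. Here
`Sum.inl` stands for the forms `M`, and `Sum.inr` for the forms `L`. -/
def formKey (r u : ℕ) : ℕ ⊕ ℕ :=
  if Even r then Sum.inr (u + (r - 2) / 2) else Sum.inl (u + (r - 1) / 2)

/-- The indices of the linear forms which generate the component belonging to the exponent
`a = (a_1, ..., a_c)`: with the partial sums `s_k = a_1 + ... + a_k`, they are
`formKey (c + 1 - k) (t - s_k)` for `1 ≤ k ≤ c`. -/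
noncomputable def keys : (c : ℕ) → ℕ → (Fin c →₀ ℕ) → Finset (ℕ ⊕ ℕ)
  | 0, _, _ => ∅
  | c + 1, t, a => insert (formKey (c + 1) (t - a 0)) (keys c (t - a 0) a.tail)

theorem exists_of_mem_keys {c t : ℕ} {a : Fin c →₀ ℕ} {x : ℕ ⊕ ℕ} (hx : x ∈ keys c t a) :
    ∃ r u, 1 ≤ r ∧ r ≤ c ∧ u ≤ t ∧ x = formKey r u := by
  induction c generalizing t with
  | zero => simp [keys] at hx
  | succ c ih =>
    rw [keys, Finset.mem_insert] at hx
    rcases hx with rfl | hx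
    · exact ⟨c + 1, t - a 0, by omega, le_rfl, by omega, rfl⟩
    · obtain ⟨r, u, h1, h2, h3, h4⟩ := ih hx
      exact ⟨r, u, h1, by omega, by omega, h4⟩

theorem formKey_ne {r u r' u' : ℕ} (h1 : 1 ≤ r) (hr : r ≤ r') (hu : u ≤ u') (h : r < r' ∨ u < u') :
    formKey r u ≠ formKey r' u' := by
  unfold formKey
  split_ifs with h1 h2 h2
  · rw [Nat.even_iff] at h1 h2
    intro he
    have := Sum.inr_injective he
    omega
  · simp
  · simp
  · rw [Nat.not_even_iff] at h1 h2
    intro he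
    have := Sum.inl_injective he
    omega

theorem card_keys_le (c t : ℕ) (a : Fin c →₀ ℕ) : (keys c t a).card ≤ c := by
  induction c generalizing t with
  | zero => simp [keys]
  | succ c ih => exact (Finset.card_insert_le _ _).trans (by simpa using ih _ _)

theorem formKey_notMem_keys (c t : ℕ) (a : Fin c →₀ ℕ) : formKey (c + 1) t ∉ keys c t a := by
  intro h
  obtain ⟨r, u, h1, h2, h3, h4⟩ := exists_of_mem_keys h
  exact formKey_ne h1 (by omega) h3 (Or.inl (by omega)) h4.symm

theorem formKey_notMem_keys_of_lt {c t u : ℕ} (hu : u < t) (a : Fin c →₀ ℕ) :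
    formKey c t ∉ keys c u a := by
  intro h
  obtain ⟨r, w, h1, h2, h3, h4⟩ := exists_of_mem_keys h
  exact formKey_ne h1 h2 (by omega) (Or.inr (by omega)) h4.symm

theorem keys_cons_zero (c t : ℕ) (a : Fin c →₀ ℕ) :
    keys (c + 1) t (Finsupp.cons 0 a) = insert (formKey (c + 1) t) (keys c t a) := by
  simp [keys]

theorem keys_add_single {c t k : ℕ} (a : Fin (c + 1) →₀ ℕ) :
    keys (c + 1) t (a + Finsupp.single 0 k) = keys (c + 1) (t - k) a := by
  have : t - (a 0 + k) = t - k - a 0 := by omega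
  simp [keys, tail_add_single_zero, this]

/-- A power of the first variable may be replaced by the same power of the second one. -/
theorem IsStronglyStable.cons_zero_mem {c : ℕ} {A : Set (Fin (c + 2) →₀ ℕ)}
    (hA : IsStronglyStable A)
    {j : ℕ} {a : Fin (c + 1) →₀ ℕ} (ha : Finsupp.cons j a ∈ A) :
    Finsupp.cons 0 (a + Finsupp.single 0 j) ∈ A := by
  induction j generalizing a with
  | zero => simpa using ha
  | succ j ih =>
    rw [← cons_add_single_zero] at ha
    have := hA.mem_of_lt (j := (0 : Fin (c + 1)).succ) ha (Fin.succ_pos _)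
    rw [cons_add_single_succ] at this
    have := ih this
    rwa [add_assoc a, ← Finsupp.single_add, add_comm 1 j] at this

section
variable {R : Type*} [CommRing R]

/-- The intersection, over all exponents `a ∈ A`, of the ideals generated by the elements of the
family with indices in `keys c t a` together with those with indices in a fixed set `U`. -/
noncomputable def configInter (f : ℕ ⊕ ℕ → R) (U : Finset (ℕ ⊕ ℕ)) (c t : ℕ)
    (A : Set (Fin c →₀ ℕ)) : Ideal R :=
  ⨅ a ∈ A, Ideal.span (f '' ((U ∪ keys c t a : Finset (ℕ ⊕ ℕ)) : Set (ℕ ⊕ ℕ)))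

theorem mem_configInter {f : ℕ ⊕ ℕ → R} {U : Finset (ℕ ⊕ ℕ)} {c t : ℕ} {A : Set (Fin c →₀ ℕ)}
    {x : R} :
    x ∈ configInter f U c t A ↔
      ∀ a ∈ A, x ∈ Ideal.span (f '' ((U ∪ keys c t a : Finset (ℕ ⊕ ℕ)) : Set (ℕ ⊕ ℕ))) := by
  simp [configInter]

theorem configInter_empty (f : ℕ ⊕ ℕ → R) (U : Finset (ℕ ⊕ ℕ)) (c t : ℕ) :
    configInter f U c t ∅ = ⊤ := by
  simp [configInter]

theorem span_image_mono {f : ℕ ⊕ ℕ → R} {U V : Finset (ℕ ⊕ ℕ)} (h : U ⊆ V) :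
    Ideal.span (f '' (U : Set (ℕ ⊕ ℕ))) ≤ Ideal.span (f '' (V : Set (ℕ ⊕ ℕ))) :=
  Ideal.span_mono (Set.image_mono (by exact_mod_cast h))

/-- The exponents in `A` which begin with `0` contribute the components containing the element with
index `formKey (c + 1) t`; the others contribute the configuration of the shifted set, with `t - 1`
in place of `t`. -/
theorem configInter_succ (f : ℕ ⊕ ℕ → R) (U : Finset (ℕ ⊕ ℕ)) (c t : ℕ)
    (A : Set (Fin (c + 1) →₀ ℕ)) :
    configInter f U (c + 1) t A =
      configInter f (insert (formKey (c + 1) t) U) c t (sliceSet A 0) ⊓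
        configInter f U (c + 1) (t - 1) (shiftSet A) := by
  ext x
  rw [Submodule.mem_inf, mem_configInter, mem_configInter, mem_configInter]
  have h1 : ∀ a, insert (formKey (c + 1) t) U ∪ keys c t a =
      U ∪ keys (c + 1) t (Finsupp.cons 0 a) := fun a => by
    rw [keys_cons_zero, Finset.insert_union, Finset.union_insert]
  have h2 : ∀ a, keys (c + 1) (t - 1) a = keys (c + 1) t (a + Finsupp.single 0 1) := fun a => by
    rw [keys_add_single]
  simp only [h1, h2]
  constructor
  · exact fun h => ⟨fun a ha => h _ ha, fun a ha => h _ ha⟩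
  · rintro ⟨h, h'⟩ a ha
    induction a using expInduction with
    | cons_zero a => exact h a ha
    | add_single a => exact h' a ha

/-- This is where strong stability enters: moving the exponents of the first variable to the second
one shows that each component of the residual configuration lies in a component, of codimension one
less, of the configuration of the slice. -/
theorem configInter_sliceSet_le (f : ℕ ⊕ ℕ → R) (U : Finset (ℕ ⊕ ℕ)) (c t : ℕ)
    {A : Set (Fin (c + 1) →₀ ℕ)}
    (hA : IsStronglyStable A) :
    configInter f U c t (sliceSet A 0) ≤ configInter f U (c + 1) (t - 1) (shiftSet A) := by
  intro x hx
  rw [mem_configInter] at hx ⊢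
  intro a ha
  have ha' : Finsupp.cons (a 0 + 1) a.tail ∈ A := by
    rw [← cons_add_single_zero, Finsupp.cons_tail]; exact ha
  have hk : keys c (t - 1 - a 0) a.tail ⊆ keys (c + 1) (t - 1) a := by
    rw [keys]; exact Finset.subset_insert _ _
  cases c with
  | zero =>
    refine span_image_mono ?_ (hx 0 (hA.mem_of_le ha' ?_))
    · exact Finset.union_subset_union_right (by simp [keys])
    · rw [Subsingleton.elim a.tail 0]
      intro i; induction i using Fin.cases <;> simp
  | succ c =>
    refine span_image_mono ?_ (hx _ (hA.cons_zero_mem ha'))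
    refine Finset.union_subset_union_right ?_
    rw [keys_add_single, show t - (a 0 + 1) = t - 1 - a 0 by omega]
    exact hk

/-- Subsets of at most `C` elements of the family generate prime ideals which contain no further
element of the family. -/
def IsGeneric (f : ℕ ⊕ ℕ → R) (W : Finset (ℕ ⊕ ℕ)) (C : ℕ) : Prop :=
  ∀ s ⊆ W, s.card ≤ C → (Ideal.span (f '' (s : Set (ℕ ⊕ ℕ)))).IsPrime ∧
    ∀ i ∈ W, i ∉ s → f i ∉ Ideal.span (f '' (s : Set (ℕ ⊕ ℕ)))

variable {f : ℕ ⊕ ℕ → R} {W : Finset (ℕ ⊕ ℕ)} {C : ℕ}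

/-- All indices which can occur in `keys c t a` lie in `W` and not in `U`. -/
def KeysAvoid (W U : Finset (ℕ ⊕ ℕ)) (c t : ℕ) : Prop :=
  ∀ r u, 1 ≤ r → r ≤ c → u ≤ t → formKey r u ∈ W ∧ formKey r u ∉ U

theorem KeysAvoid.mono {U : Finset (ℕ ⊕ ℕ)} {c t c' t' : ℕ} (h : KeysAvoid W U c t) (hc : c' ≤ c)
    (ht : t' ≤ t) : KeysAvoid W U c' t' :=
  fun r u h1 h2 h3 => h r u h1 (h2.trans hc) (h3.trans ht)

theorem KeysAvoid.insert {U : Finset (ℕ ⊕ ℕ)} {c t : ℕ} (h : KeysAvoid W U (c + 1) t) :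
    KeysAvoid W (insert (formKey (c + 1) t) U) c t := by
  intro r u h1 h2 h3
  refine ⟨(h r u h1 (by omega) h3).1, ?_⟩
  rw [Finset.mem_insert, not_or]
  exact ⟨formKey_ne h1 (by omega) h3 (Or.inl (by omega)), (h r u h1 (by omega) h3).2⟩

theorem KeysAvoid.keys_subset {U : Finset (ℕ ⊕ ℕ)} {c t : ℕ} (h : KeysAvoid W U c t)
    (a : Fin c →₀ ℕ) : keys c t a ⊆ W := by
  intro x hx
  obtain ⟨r, u, h1, h2, h3, rfl⟩ := exists_of_mem_keys hx
  exact (h r u h1 h2 h3).1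

theorem degree_lt_of_mem_shiftSet {c t : ℕ} {A : Set (Fin (c + 1) →₀ ℕ)}
    (hd : ∀ a ∈ A, a.degree ≤ t)
    {a : Fin (c + 1) →₀ ℕ} (ha : a ∈ shiftSet A) : a.degree < t := by
  have := hd _ ha
  rw [map_add, Finsupp.degree_single] at this
  omega

theorem degree_le_of_mem_sliceSet {c t : ℕ} {A : Set (Fin (c + 1) →₀ ℕ)}
    (hd : ∀ a ∈ A, a.degree ≤ t)
    {a : Fin c →₀ ℕ} {j : ℕ} (ha : a ∈ sliceSet A j) : a.degree ≤ t - j := by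
  have := hd _ ha
  rw [degree_cons] at this
  omega

/-- The element with index `formKey (c + 1) t` is a nonzerodivisor modulo the residual intersection:
it lies in none of its components, which are prime. -/
theorem mul_mem_configInter_shiftSet_iff (hf : IsGeneric f W C) {U : Finset (ℕ ⊕ ℕ)} (hU : U ⊆ W)
    {c t : ℕ}
    {A : Set (Fin (c + 1) →₀ ℕ)} (hd : ∀ a ∈ A, a.degree ≤ t) (hk : KeysAvoid W U (c + 1) t)
    (hC : U.card + (c + 1) ≤ C) {y : R} :
    f (formKey (c + 1) t) * y ∈ configInter f U (c + 1) (t - 1) (shiftSet A) ↔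
      y ∈ configInter f U (c + 1) (t - 1) (shiftSet A) := by
  refine ⟨fun h => ?_, fun h => Ideal.mul_mem_left _ _ h⟩
  rw [mem_configInter] at h ⊢
  intro a ha
  have hlt := degree_lt_of_mem_shiftSet hd ha
  obtain ⟨hp, hnot⟩ := hf (U ∪ keys (c + 1) (t - 1) a)
    (Finset.union_subset hU ((hk.mono le_rfl (by omega)).keys_subset a))
    ((Finset.card_union_le _ _).trans ((Nat.add_le_add_left (card_keys_le _ _ _) _).trans hC))
  obtain ⟨h1, h2⟩ := hk (c + 1) t (by omega) le_rfl le_rfl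
  refine (hp.mem_or_mem (h a ha)).resolve_left (hnot _ h1 ?_)
  rw [Finset.mem_union, not_or]
  exact ⟨h2, formKey_notMem_keys_of_lt (by omega) a⟩

/-- Adding the elements with indices in `U` to all components is the same as adding them to the
intersection. -/
theorem configInter_eq_sup (hf : IsGeneric f W C) {c t : ℕ} {A : Set (Fin c →₀ ℕ)}
    (hA : IsStronglyStable A)
    (hd : ∀ a ∈ A, a.degree ≤ t) {U : Finset (ℕ ⊕ ℕ)} (hU : U ⊆ W) (hk : KeysAvoid W U c t)
    (hC : U.card + c ≤ C) :
    configInter f U c t A = Ideal.span (f '' (U : Set (ℕ ⊕ ℕ))) ⊔ configInter f ∅ c t A := by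
  apply le_antisymm
  swap
  · refine sup_le (fun x hx => mem_configInter.2 fun a _ => ?_)
        (fun x hx => mem_configInter.2 fun a ha => ?_)
    · exact span_image_mono Finset.subset_union_left hx
    · refine span_image_mono ?_ (mem_configInter.1 hx a ha)
      exact Finset.union_subset_union_left (by simp)
  induction c generalizing t U with
  | zero =>
    intro x hx
    rcases A.eq_empty_or_nonempty with rfl | ⟨a, ha⟩
    · rw [configInter_empty f ∅, sup_top_eq]; trivial
    · have := mem_configInter.1 hx a ha
      simp only [keys, Finset.union_empty] at this
      exact Ideal.mem_sup_left this
  | succ c ihc =>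
    induction t using Nat.strong_induction_on generalizing A with
    | _ t iht =>
    intro x hx
    have hℓ := hk (c + 1) t (by omega) le_rfl le_rfl
    have hB : configInter f U (c + 1) (t - 1) (shiftSet A) ≤
        Ideal.span (f '' (U : Set (ℕ ⊕ ℕ))) ⊔ configInter f ∅ (c + 1) (t - 1) (shiftSet A) := by
      rcases Nat.eq_zero_or_pos t with rfl | ht
      · have : shiftSet A = ∅ := Set.eq_empty_of_forall_notMem fun a ha =>
          absurd (degree_lt_of_mem_shiftSet hd ha) (by omega)
        rw [this, configInter_empty, configInter_empty, sup_top_eq]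
      · refine iht (t - 1) (by omega) hA.shiftSet (fun a ha => ?_) (hk.mono le_rfl (by omega))
        have := degree_lt_of_mem_shiftSet hd ha
        omega
    rw [configInter_succ] at hx
    have h1 := ihc (t := t) (U := insert (formKey (c + 1) t) U) (hA.sliceSet 0)
      (fun a ha => degree_le_of_mem_sliceSet hd ha) (Finset.insert_subset hℓ.1 hU) hk.insert
      (by rw [Finset.card_insert_of_notMem hℓ.2]; omega) hx.1
    rw [Finset.coe_insert, Set.image_insert_eq, Ideal.span_insert, Submodule.mem_sup] at h1
    -- An element of the left side is now `y * ℓ + b + g` with `ℓ` the distinguished element, `b` in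
    -- the ideal of `U`, and `g` in the slice; the residual part shows that `y` lies in the residual
    -- configuration, to which the induction on `t` applies.
    obtain ⟨z, hz, g, hg, rfl⟩ := h1
    rw [Submodule.mem_sup] at hz
    obtain ⟨z, hz, b, hb, rfl⟩ := hz
    obtain ⟨y, rfl⟩ := Ideal.mem_span_singleton'.1 hz
    have hg' := configInter_sliceSet_le f ∅ c t hA hg
    have hy : y ∈ configInter f U (c + 1) (t - 1) (shiftSet A) := by
      rw [← mul_mem_configInter_shiftSet_iff hf hU hd hk hC, mul_comm]
      have hb' : b ∈ configInter f U (c + 1) (t - 1) (shiftSet A) :=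
        mem_configInter.2 fun a _ => span_image_mono Finset.subset_union_left hb
      have hg'' : g ∈ configInter f U (c + 1) (t - 1) (shiftSet A) :=
        mem_configInter.2 fun a ha => span_image_mono (Finset.union_subset_union_left (by simp))
          (mem_configInter.1 hg' a ha)
      have := Ideal.sub_mem _ (Ideal.sub_mem _ hx.2 hg'') hb'
      convert this using 1
      ring
    obtain ⟨b', hb', g', hg₁, rfl⟩ := Submodule.mem_sup.1 (hB hy)
    have h2 : (b' + g') * f (formKey (c + 1) t) + b + g =
        (b' * f (formKey (c + 1) t) + b) + (g' * f (formKey (c + 1) t) + g) := by ring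
    rw [h2]
    refine Ideal.add_mem _ (Ideal.mem_sup_left (Ideal.add_mem _ (Ideal.mul_mem_right _ _ hb') hb))
      (Ideal.mem_sup_right ?_)
    rw [configInter_succ]
    refine ⟨mem_configInter.2 fun a ha => Ideal.add_mem _ (Ideal.mul_mem_left _ _ ?_) ?_,
      Ideal.add_mem _ (Ideal.mul_mem_right _ _ hg₁) hg'⟩
    · exact Ideal.subset_span ⟨_, by simp, rfl⟩
    · exact span_image_mono (Finset.union_subset_union_left (by simp)) (mem_configInter.1 hg a ha)

/-- The sum of the configuration ideal with its distinguished element is the configuration ideal of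
the slice `sliceSet A 0`, with that element added to all components. -/
theorem configInter_sup_span (hf : IsGeneric f W C) {U : Finset (ℕ ⊕ ℕ)} (hU : U ⊆ W) {c t : ℕ}
    {A : Set (Fin (c + 1) →₀ ℕ)} (hA : IsStronglyStable A) (hd : ∀ a ∈ A, a.degree ≤ t)
    (hk : KeysAvoid W U (c + 1) t) (hC : U.card + (c + 1) ≤ C) :
    configInter f U (c + 1) t A ⊔ Ideal.span {f (formKey (c + 1) t)} =
      configInter f (insert (formKey (c + 1) t) U) c t (sliceSet A 0) := by
  have hℓ := hk (c + 1) t (by omega) le_rfl le_rfl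
  apply le_antisymm
  · rw [configInter_succ]
    refine sup_le inf_le_left ?_
    rw [Ideal.span_singleton_le_iff_mem]
    exact mem_configInter.2 fun a _ => Ideal.subset_span ⟨_, by simp, rfl⟩
  · rw [configInter_eq_sup (t := t) hf (hA.sliceSet 0) (fun a ha => degree_le_of_mem_sliceSet hd ha)
      (Finset.insert_subset hℓ.1 hU) hk.insert
      (by rw [Finset.card_insert_of_notMem hℓ.2]; omega), Finset.coe_insert, Set.image_insert_eq,
      Ideal.span_insert]
    refine sup_le (sup_le le_sup_right ?_) ?_
    · refine le_sup_of_le_left fun x hx => mem_configInter.2 fun a _ => ?_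
      exact span_image_mono Finset.subset_union_left hx
    · refine le_sup_of_le_left ?_
      rw [configInter_succ]
      refine fun x hx => ⟨mem_configInter.2 fun a ha => ?_, mem_configInter.2 fun a ha => ?_⟩
      · exact span_image_mono (Finset.union_subset_union_left (by simp)) (mem_configInter.1 hx a ha)
      · exact span_image_mono (Finset.union_subset_union_left (by simp))
          (mem_configInter.1 (configInter_sliceSet_le f ∅ c t hA hx) a ha)

/-- The ideal quotient of the configuration ideal by its distinguished element is the configuration
ideal of the shifted set. -/
theorem mul_mem_configInter_iff (hf : IsGeneric f W C) {U : Finset (ℕ ⊕ ℕ)} (hU : U ⊆ W) {c t : ℕ}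
    {A : Set (Fin (c + 1) →₀ ℕ)} (hd : ∀ a ∈ A, a.degree ≤ t) (hk : KeysAvoid W U (c + 1) t)
    (hC : U.card + (c + 1) ≤ C) {y : R} :
    f (formKey (c + 1) t) * y ∈ configInter f U (c + 1) t A ↔
      y ∈ configInter f U (c + 1) (t - 1) (shiftSet A) := by
  rw [← mul_mem_configInter_shiftSet_iff hf hU hd hk hC, configInter_succ, Submodule.mem_inf]
  refine and_iff_right (mem_configInter.2 fun a _ => Ideal.mul_mem_right _ _ ?_)
  exact Ideal.subset_span ⟨_, by simp, rfl⟩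

end

end

/-! ### The ideal `I_{c,t}(h)` as an intersection -/

section

variable {K : Type*} [Field K]

theorem formKey_one (u : ℕ) : formKey 1 u = Sum.inl u := by
  simp [formKey]

/-- In codimension one, the components belong to the exponents `0, ..., v`, where `v` is the last
degree of the Hilbert function; their generators are pairwise nonassociated primes, so that the
intersection is generated by the product. -/
theorem configIdeal_one_eq_configInter {n t C : ℕ} {M L : ℕ → MvPolynomial (Fin (n + 1)) K}
    {W : Finset (ℕ ⊕ ℕ)} (hf : IsGeneric (Sum.elim M L) W C) (hC : 1 ≤ C) (hk : KeysAvoid W ∅ 1 t)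
    {J : Ideal (MvPolynomial (Fin 1) K)} (hJ : IsLexSegment J) (hne : (stdExps J).Nonempty)
    (hd : ∀ a ∈ stdExps J, a.degree ≤ t) :
    Ideal.span {∏ i ∈ Finset.Icc (t - lastDegree (hilbertFn J)) t, M i} =
      configInter (Sum.elim M L) ∅ 1 t (stdExps J) := by
  have hsingle : ∀ a : Fin 1 →₀ ℕ, a = Finsupp.single 0 (a 0) := fun a => by
    refine Finsupp.ext fun i => ?_
    rw [Subsingleton.elim i 0, Finsupp.single_eq_same]
  have hS : {i | hilbertFn J i ≠ 0} = {i | Finsupp.single 0 i ∈ stdExps J} := by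
    ext i
    rw [Set.mem_ofPred_eq, Set.mem_ofPred_eq, hilbertFn_eq_ncard hJ.isMonomial, ← pos_iff_ne_zero,
      Set.ncard_pos ((finite_degree_eq 1 i).subset fun _ hb => hb.2)]
    constructor
    · rintro ⟨a, ha, hai⟩
      rw [hsingle a, Finsupp.degree_single] at hai
      rwa [← hai, ← hsingle]
    · exact fun h => ⟨_, h, by simp⟩
  have hbdd : BddAbove {i | Finsupp.single 0 i ∈ stdExps J} := ⟨t, fun i hi => by
    simpa using hd _ hi⟩
  have hw : lastDegree (hilbertFn J) ∈ {i | Finsupp.single 0 i ∈ stdExps J} := by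
    rw [lastDegree, hS]
    refine Nat.sSup_mem ?_ hbdd
    obtain ⟨a, ha⟩ := hne
    exact ⟨a 0, by rw [Set.mem_ofPred_eq, ← hsingle]; exact ha⟩
  have hle : ∀ i, Finsupp.single 0 i ∈ stdExps J ↔ i ≤ lastDegree (hilbertFn J) := fun i => by
    refine ⟨fun h => ?_, fun h => hJ.isStronglyStable.mem_of_le hw (Finsupp.single_mono h)⟩
    rw [lastDegree, hS]
    exact le_csSup hbdd h
  have hwt : lastDegree (hilbertFn J) ≤ t := by simpa using hd _ hw
  have hprime : ∀ i ≤ t, Prime (M i) := fun i hi => by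
    have hiW := (hk 1 i le_rfl le_rfl hi).1
    rw [formKey_one] at hiW
    have h0 := (hf ∅ (by simp) (by simp)).2 _ hiW (by simp)
    have h1 := (hf {Sum.inl i} (by simpa using hiW) (by simpa using hC)).1
    simp only [Finset.coe_empty, Set.image_empty, Ideal.span_empty, Submodule.mem_bot,
      Sum.elim_inl] at h0
    simp only [Finset.coe_singleton, Set.image_singleton, Sum.elim_inl] at h1
    rwa [Ideal.span_singleton_prime h0] at h1
  ext x
  rw [Ideal.mem_span_singleton, mem_configInter]
  have hkey : ∀ a : Fin 1 →₀ ℕ, (Sum.elim M L) ''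
      ((∅ ∪ keys 1 t a : Finset (ℕ ⊕ ℕ)) : Set (ℕ ⊕ ℕ)) =
      {M (t - a 0)} := fun a => by
    simp [keys, formKey_one]
  simp only [hkey, Ideal.mem_span_singleton]
  constructor
  · intro h a ha
    refine (Finset.dvd_prod_of_mem M ?_).trans h
    rw [hsingle a, hle] at ha
    rw [Finset.mem_Icc]
    omega
  · intro h
    refine Finset.prod_dvd_of_isRelPrime ?_ fun i hi => ?_
    · intro i hi j hj hij
      rw [Finset.coe_Icc] at hi hj
      change IsRelPrime (M i) (M j)
      rw [(hprime i hi.2).irreducible.isRelPrime_iff_not_dvd]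
      intro hdvd
      have hiW := (hk 1 i le_rfl le_rfl hi.2).1
      have hjW := (hk 1 j le_rfl le_rfl hj.2).1
      rw [formKey_one] at hiW hjW
      refine (hf {Sum.inl i} (by simpa using hiW) (by simpa using hC)).2 _ hjW
          (by simpa using hij.symm) ?_
      simpa [Ideal.mem_span_singleton] using hdvd
    · rw [Finset.mem_Icc] at hi
      have := h (Finsupp.single 0 (t - i)) ((hle _).2 (by omega))
      rwa [Finsupp.single_eq_same, Nat.sub_sub_self hi.2] at this

theorem elim_formKey {n : ℕ} (M L : ℕ → MvPolynomial (Fin (n + 1)) K) (r u : ℕ) :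
    Sum.elim M L (formKey r u) = if Even r then L (u + (r - 2) / 2) else M (u + (r - 1) / 2) := by
  unfold formKey
  split_ifs <;> rfl

/-- The ideal `I_{c,t}(h)` is the intersection of the ideals generated by `c` of the linear forms
which belong to the standard monomials of the lex-segment ideal of `h`. -/
theorem configIdeal_eq_configInter {n c t C : ℕ} {M L : ℕ → MvPolynomial (Fin (n + 1)) K}
    {W : Finset (ℕ ⊕ ℕ)} (hf : IsGeneric (Sum.elim M L) W C) (hC : c + 1 ≤ C)
    (hk : KeysAvoid W ∅ (c + 1) t) {h : ℕ → ℕ} (H : IsLexHilbertFn K (c + 1) h)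
    (hne : (stdExps (lexIdeal K (c + 1) h)).Nonempty)
    (hd : ∀ a ∈ stdExps (lexIdeal K (c + 1) h), a.degree ≤ t) :
    configIdeal M L (c + 1) t h = configInter (Sum.elim M L) ∅ (c + 1) t
        (stdExps (lexIdeal K (c + 1) h)) := by
  induction c generalizing t h with
  | zero =>
    obtain ⟨hlex, -, hh⟩ := H.lexIdeal_spec
    rw [← configIdeal_one_eq_configInter hf hC hk hlex hne hd, configIdeal,
        show hilbertFn _ = h from funext hh]
  | succ c ih =>
    obtain ⟨hlex, -, hh⟩ := H.lexIdeal_spec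
    set A := stdExps (lexIdeal K (c + 2) h) with hAdef
    have hstep : ∀ j < initialDegree (lexIdeal K (c + 2) h),
        configIdeal M L (c + 1) (t - j) (decomp K (c + 1) h j) ⊔
          Ideal.span {if Even (c + 2) then L (t - j + (c + 2 - 2) / 2)
            else M (t - j + (c + 2 - 1) / 2)} =
        configInter (Sum.elim M L) {formKey (c + 2) (t - j)} (c + 1) (t - j) (sliceSet A j) := by
      intro j hj
      obtain ⟨h1, h2⟩ := lexIdeal_decomp H hd j
      have h3 : stdExps (lexIdeal K (c + 1) (decomp K (c + 1) h j)) = sliceSet A j := by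
        rw [h2, stdExps_slice]
      have hk1 : KeysAvoid W ∅ (c + 2) (t - j) := hk.mono le_rfl (by omega)
      rw [ih (t := t - j) (by omega) (hk1.mono (by omega) le_rfl) h1
        (by rw [h3]; exact (lt_initialDegree_iff hlex hd j).1 hj)
        (by rw [h3]; exact fun a ha => degree_le_of_mem_sliceSet hd ha), h3, ← elim_formKey,
        configInter_eq_sup hf (hlex.isStronglyStable.sliceSet j)
          (fun a ha => degree_le_of_mem_sliceSet hd ha) (U := {formKey (c + 2) (t - j)})
          (by simpa using (hk1 (c + 2) (t - j) (by omega) le_rfl le_rfl).1) hk1.insert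
          (by simp; omega), sup_comm]
      simp [hAdef]
    rw [configIdeal]
    ext x
    rw [mem_configInter]
    simp only [Submodule.mem_iInf, Finset.mem_range]
    have hkeys : ∀ j (a : Fin (c + 1) →₀ ℕ), ∅ ∪ keys (c + 2) t (Finsupp.cons j a) =
        {formKey (c + 2) (t - j)} ∪ keys (c + 1) (t - j) a := fun j a => by
      rw [keys, Finset.empty_union, Finsupp.cons_zero, Finsupp.tail_cons, Finset.insert_eq]
    constructor
    · intro hx a ha
      rw [← Finsupp.cons_tail a] at ha ⊢
      have := hx (a 0) ((lt_initialDegree_iff hlex hd _).2 ⟨_, ha⟩)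
      rw [hstep _ ((lt_initialDegree_iff hlex hd _).2 ⟨_, ha⟩)] at this
      rw [hkeys]
      exact mem_configInter.1 this _ ha
    · intro hx j hj
      rw [hstep j hj, mem_configInter]
      intro a ha
      rw [← hkeys]
      exact hx _ ha

end

/-! ### Hilbert series and linear forms -/

section

variable {K : Type*} [Field K] {N : ℕ}

theorem homogeneousComponent_succ_mul {ℓ : MvPolynomial (Fin N) K} (hℓ : ℓ.IsHomogeneous 1)
    (y : MvPolynomial (Fin N) K) (d : ℕ) :
    homogeneousComponent (d + 1) (ℓ * y) = ℓ * homogeneousComponent d y := by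
  classical
  have h : ∀ k, ℓ * homogeneousComponent k y ∈ homogeneousSubmodule (Fin N) K (k + 1) := fun k => by
    rw [mem_homogeneousSubmodule, add_comm]
    exact hℓ.mul (homogeneousComponent_isHomogeneous k y)
  conv_lhs => rw [← sum_homogeneousComponent y]
  rw [Finset.mul_sum, map_sum]
  simp_rw [homogeneousComponent_of_mem (h _)]
  simp only [add_left_inj, Finset.sum_ite_eq, Finset.mem_range]
  split_ifs with hd
  · rfl
  · rw [homogeneousComponent_eq_zero _ _ (by omega), mul_zero]

theorem homogeneousComponent_zero_mul {ℓ : MvPolynomial (Fin N) K} (hℓ : ℓ.IsHomogeneous 1)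
    (y : MvPolynomial (Fin N) K) : homogeneousComponent 0 (ℓ * y) = 0 := by
  have : coeff 0 ℓ = 0 := by
    by_contra h
    have := hℓ h
    simp at this
  rw [homogeneousComponent_zero, ← constantCoeff_eq, map_mul, constantCoeff_eq, this, zero_mul, C_0]

instance (d : ℕ) : FiniteDimensional K (homogeneousSubmodule (Fin N) K d) :=
  Module.Finite.iff_fg.2 (homogeneousSubmodule_fg _ _ _)

/-- The forms of degree `d` in `I`. -/
noncomputable def formsIn (I : Ideal (MvPolynomial (Fin N) K)) (d : ℕ) :
    Submodule K (MvPolynomial (Fin N) K) :=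
  homogeneousSubmodule (Fin N) K d ⊓ I.restrictScalars K

instance (I : Ideal (MvPolynomial (Fin N) K)) (d : ℕ) : FiniteDimensional K (formsIn I d) :=
  Submodule.finiteDimensional_inf_left _ _

theorem mem_formsIn {I : Ideal (MvPolynomial (Fin N) K)} {d : ℕ} {x : MvPolynomial (Fin N) K} :
    x ∈ formsIn I d ↔ x.IsHomogeneous d ∧ x ∈ I := Iff.rfl

theorem hilbertFn_add_finrank (I : Ideal (MvPolynomial (Fin N) K)) (d : ℕ) :
    hilbertFn I d + Module.finrank K (formsIn I d) =
      Module.finrank K (homogeneousSubmodule (Fin N) K d) := by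
  let φ := (Ideal.Quotient.mkₐ K I).toLinearMap.domRestrict (homogeneousSubmodule (Fin N) K d)
  have h1 : LinearMap.range φ =
      (homogeneousSubmodule (Fin N) K d).map (Ideal.Quotient.mkₐ K I).toLinearMap :=
    LinearMap.range_domRestrict _ _
  have h2 : (LinearMap.ker φ).map (homogeneousSubmodule (Fin N) K d).subtype = formsIn I d := by
    ext x
    simp only [Submodule.mem_map, LinearMap.mem_ker, mem_formsIn]
    constructor
    · rintro ⟨y, hy, rfl⟩
      exact ⟨y.2, Ideal.Quotient.eq_zero_iff_mem.1 hy⟩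
    · rintro ⟨hx, hxI⟩
      exact ⟨⟨x, hx⟩, Ideal.Quotient.eq_zero_iff_mem.2 hxI, rfl⟩
  have h3 := LinearMap.finrank_range_add_finrank_ker φ
  have h4 := (Submodule.equivMapOfInjective _
    (homogeneousSubmodule (Fin N) K d).injective_subtype (LinearMap.ker φ)).finrank_eq
  rw [h2] at h4
  rw [h1, h4] at h3
  exact h3

/-- Homogeneous ideals: with a polynomial, the ideal contains its homogeneous components. -/
def IsHomogeneousIdeal (I : Ideal (MvPolynomial (Fin N) K)) : Prop :=
  ∀ f ∈ I, ∀ d, homogeneousComponent d f ∈ I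

theorem IsHomogeneousIdeal.sup_span {I : Ideal (MvPolynomial (Fin N) K)} (hI : IsHomogeneousIdeal I)
    {ℓ : MvPolynomial (Fin N) K} (hℓ : ℓ.IsHomogeneous 1) :
    IsHomogeneousIdeal (I ⊔ Ideal.span {ℓ}) := by
  intro f hf d
  obtain ⟨g, hg, z, hz, rfl⟩ := Submodule.mem_sup.1 hf
  obtain ⟨y, rfl⟩ := Ideal.mem_span_singleton.1 hz
  rw [map_add]
  refine Ideal.add_mem _ (Ideal.mem_sup_left (hI g hg d)) (Ideal.mem_sup_right ?_)
  cases d with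
  | zero => rw [homogeneousComponent_zero_mul hℓ]; exact zero_mem _
  | succ d =>
    rw [homogeneousComponent_succ_mul hℓ]
    exact Ideal.mem_span_singleton.2 (Dvd.intro _ rfl)

theorem IsHomogeneousIdeal.span {s : Finset (MvPolynomial (Fin N) K)}
    (hs : ∀ f ∈ s, f.IsHomogeneous 1) :
    IsHomogeneousIdeal (Ideal.span (s : Set (MvPolynomial (Fin N) K))) := by
  classical
  induction s using Finset.induction_on with
  | empty =>
    intro f hf d
    rw [Finset.coe_empty, Ideal.span_empty, Submodule.mem_bot] at hf
    rw [hf, map_zero]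
    exact zero_mem _
  | insert ℓ s _ ih =>
    rw [Finset.coe_insert, Ideal.span_insert, sup_comm]
    exact (ih fun f hf => hs f (Finset.mem_insert_of_mem hf)).sup_span
        (hs _ (Finset.mem_insert_self _ _))

/-- The Hilbert series of the quotient by a homogeneous ideal. -/
noncomputable def hilbertSeries (I : Ideal (MvPolynomial (Fin N) K)) : PowerSeries ℤ :=
  PowerSeries.mk fun d => (hilbertFn I d : ℤ)

/-- Additivity of the Hilbert series on `0 → (R / (I : ℓ))(-1) → R / I → R / (I + (ℓ)) → 0`. -/
theorem hilbertSeries_eq {I I' : Ideal (MvPolynomial (Fin N) K)} (hI : IsHomogeneousIdeal I)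
    {ℓ : MvPolynomial (Fin N) K} (hℓ : ℓ.IsHomogeneous 1) (hℓ0 : ℓ ≠ 0)
        (h : ∀ y, ℓ * y ∈ I ↔ y ∈ I') :
    hilbertSeries I = PowerSeries.X * hilbertSeries I' + hilbertSeries (I ⊔ Ideal.span {ℓ}) := by
  ext d
  cases d with
  | zero =>
    have h1 : formsIn (I ⊔ Ideal.span {ℓ}) 0 = formsIn I 0 := by
      ext x
      rw [mem_formsIn, mem_formsIn]
      refine and_congr_right fun hx => ⟨fun hxI => ?_, fun hxI => Ideal.mem_sup_left hxI⟩
      obtain ⟨g, hg, z, hz, rfl⟩ := Submodule.mem_sup.1 hxI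
      obtain ⟨y, rfl⟩ := Ideal.mem_span_singleton.1 hz
      rw [← homogeneousComponent_eq_self hx, map_add, homogeneousComponent_zero_mul hℓ, add_zero]
      exact hI g hg 0
    have h2 := hilbertFn_add_finrank I 0
    have h3 := hilbertFn_add_finrank (I ⊔ Ideal.span {ℓ}) 0
    rw [h1] at h3
    simp [hilbertSeries]
    omega
  | succ d =>
    let μ : MvPolynomial (Fin N) K →ₗ[K] MvPolynomial (Fin N) K := LinearMap.mulLeft K ℓ
    have hμ : Function.Injective μ := fun x y hxy => mul_left_cancel₀ hℓ0 hxy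
    have h1 : formsIn I (d + 1) ⊔ (homogeneousSubmodule (Fin N) K d).map μ =
        formsIn (I ⊔ Ideal.span {ℓ}) (d + 1) := by
      apply le_antisymm
      · refine sup_le (fun x hx => ⟨hx.1, Ideal.mem_sup_left hx.2⟩) ?_
        rintro _ ⟨y, hy, rfl⟩
        refine ⟨?_, Ideal.mem_sup_right (Ideal.mem_span_singleton.2 (Dvd.intro _ rfl))⟩
        change (ℓ * y).IsHomogeneous (d + 1)
        rw [add_comm]
        exact hℓ.mul hy
      · rintro x ⟨hx, hxI⟩
        obtain ⟨g, hg, z, hz, rfl⟩ := Submodule.mem_sup.1 hxI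
        obtain ⟨y, rfl⟩ := Ideal.mem_span_singleton.1 hz
        rw [← homogeneousComponent_eq_self hx, map_add, homogeneousComponent_succ_mul hℓ]
        exact Submodule.add_mem_sup ⟨homogeneousComponent_isHomogeneous _ _, hI g hg _⟩
          ⟨_, homogeneousComponent_isHomogeneous _ _, rfl⟩
    have h2 : formsIn I (d + 1) ⊓ (homogeneousSubmodule (Fin N) K d).map μ =
        (formsIn I' d).map μ := by
      ext x
      constructor
      · rintro ⟨⟨-, hxI⟩, y, hy, rfl⟩
        exact ⟨y, ⟨hy, (h y).1 hxI⟩, rfl⟩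
      · rintro ⟨y, ⟨hy, hyI⟩, rfl⟩
        refine ⟨⟨?_, (h y).2 hyI⟩, y, hy, rfl⟩
        change (ℓ * y).IsHomogeneous (d + 1)
        rw [add_comm]
        exact hℓ.mul hy
    have h3 := Submodule.finrank_sup_add_finrank_inf_eq (formsIn I (d + 1))
      ((homogeneousSubmodule (Fin N) K d).map μ)
    rw [h1, h2, ← (Submodule.equivMapOfInjective μ hμ _).finrank_eq,
      ← (Submodule.equivMapOfInjective μ hμ _).finrank_eq] at h3
    have h4 := hilbertFn_add_finrank I (d + 1)
    have h5 := hilbertFn_add_finrank (I ⊔ Ideal.span {ℓ}) (d + 1)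
    have h6 := hilbertFn_add_finrank I' d
    simp only [hilbertSeries, map_add, PowerSeries.coeff_succ_X_mul, PowerSeries.coeff_mk]
    omega

/-- The Hilbert series of a section by a linear form which is a nonzerodivisor on the quotient by
`I`. -/
theorem hilbertSeries_sup_span {I : Ideal (MvPolynomial (Fin N) K)} (hI : IsHomogeneousIdeal I)
    {ℓ : MvPolynomial (Fin N) K} (hℓ : ℓ.IsHomogeneous 1) (hℓ0 : ℓ ≠ 0)
        (h : ∀ y, ℓ * y ∈ I → y ∈ I) :
    hilbertSeries (I ⊔ Ideal.span {ℓ}) = hilbertSeries I * (1 - PowerSeries.X) := by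
  have := hilbertSeries_eq hI hℓ hℓ0 (I' := I) fun y => ⟨h y, fun hy => Ideal.mul_mem_left _ _ hy⟩
  linear_combination -this

/-- `I` is generated by `N - D` linearly independent linear forms, so that the quotient is a
polynomial ring in `D` variables. -/
def IsLinear (I : Ideal (MvPolynomial (Fin N) K)) (D : ℕ) : Prop :=
  ∃ s : Finset (MvPolynomial (Fin N) K), (∀ f ∈ s, f.IsHomogeneous 1) ∧
    LinearIndepOn K id (s : Set (MvPolynomial (Fin N) K)) ∧ I = Ideal.span s ∧ s.card + D = N

theorem finrank_homogeneousSubmodule_one :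
    Module.finrank K (homogeneousSubmodule (Fin N) K 1) = N := by
  rw [homogeneousSubmodule_one_eq_span_X, finrank_span_eq_card (linearIndependent_X (Fin N) K),
    Fintype.card_fin]

/-- A linear change of coordinates identifies the quotient with a polynomial ring in `D` variables.
Injectivity of the coordinate change follows from its surjectivity by comparing Krull dimensions. -/
theorem IsLinear.exists_ker {I : Ideal (MvPolynomial (Fin N) K)} {D : ℕ} (hI : IsLinear I D) :
    ∃ ψ : MvPolynomial (Fin N) K →ₐ[K] MvPolynomial (Fin D) K,
      Function.Surjective ψ ∧ RingHom.ker ψ = I := by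
  obtain ⟨s, hs, hli, rfl, hcard⟩ := hI
  let V := homogeneousSubmodule (Fin N) K 1
  let g : s → V := fun f => ⟨f.1, hs _ f.2⟩
  have hg : LinearIndependent K g := LinearIndependent.of_comp V.subtype hli
  have : Finite (s ⊕ Module.Basis.sumExtendIndex hg) :=
    Module.Finite.finite_basis (Module.Basis.sumExtend hg)
  have hfin : Finite (Module.Basis.sumExtendIndex hg) :=
    Finite.of_injective (Sum.inr : _ → s ⊕ Module.Basis.sumExtendIndex hg) Sum.inr_injective
  have hcardκ : Nat.card (Module.Basis.sumExtendIndex hg) = D := by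
    have h1 := Module.finrank_eq_nat_card_basis (Module.Basis.sumExtend hg)
    rw [finrank_homogeneousSubmodule_one, Nat.card_sum, Nat.card_eq_fintype_card,
      Fintype.card_coe] at h1
    omega
  let b : Module.Basis (s ⊕ Fin D) K V := (Module.Basis.sumExtend hg).reindex
    (Equiv.sumCongr (Equiv.refl s) (Finite.equivFinOfCardEq hcardκ))
  have hbl : ∀ i, (b (Sum.inl i) : MvPolynomial (Fin N) K) = i.1 := fun i => by
    simp only [b, Module.Basis.sumExtend, Module.Basis.reindex_apply,
        Module.Basis.extend_apply_self]
    rfl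
  let φ : MvPolynomial (s ⊕ Fin D) K →ₐ[K] MvPolynomial (Fin N) K := aeval fun i => (b i).1
  have hφ : Function.Surjective φ := by
    rw [← AlgHom.range_eq_top, eq_top_iff, ← adjoin_range_X, Algebra.adjoin_le_iff]
    rintro _ ⟨i, rfl⟩
    have h1 : (⟨X i, isHomogeneous_X K i⟩ : V) ∈ Submodule.span K (Set.range b) := by
      rw [b.span_eq]; trivial
    have h2 := Submodule.mem_map_of_mem (f := V.subtype) h1
    rw [Submodule.map_span] at h2
    refine (Submodule.span_le (p := φ.range.toSubmodule)).2 ?_ h2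
    rintro _ ⟨_, ⟨j, rfl⟩, rfl⟩
    exact ⟨X j, by simp [φ]⟩
  have hφi : Function.Injective φ := by
    rw [injective_iff_map_eq_zero]
    intro r hr
    by_contra hr0
    have h1 := ringKrullDim_succ_le_of_surjective φ.toRingHom hφ
      (mem_nonZeroDivisors_of_ne_zero hr0) hr
    have h0 : Nat.card (s ⊕ Fin D) = N := by simp [hcard]
    rw [MvPolynomial.ringKrullDim_of_isNoetherianRing,
        MvPolynomial.ringKrullDim_of_isNoetherianRing,
      ringKrullDim_eq_zero_of_field, h0, Nat.card_fin, zero_add] at h1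
    have h2 : ((N + 1 : ℕ) : WithBot ℕ∞) ≤ (N : ℕ) := by exact_mod_cast h1
    have h3 : N + 1 ≤ N := by exact_mod_cast h2
    omega
  let Φ := AlgEquiv.ofBijective φ ⟨hφi, hφ⟩
  -- In the new coordinates, `I` is generated by the variables in `s`.
  let π : MvPolynomial (s ⊕ Fin D) K →ₐ[K] MvPolynomial (Fin D) K := aeval (Sum.elim (fun _ => 0) X)
  have hπ : ∀ p, π (rename Sum.inr p) = p := fun p => by
    rw [show π (rename Sum.inr p) = aeval X p from aeval_rename _ _ _, aeval_X_left_apply]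
  refine ⟨π.comp Φ.symm.toAlgHom, ?_, ?_⟩
  · exact (fun p => ⟨Φ (rename Sum.inr p), by simp [hπ]⟩)
  · apply le_antisymm
    · intro x hx
      obtain ⟨p, rfl⟩ := Φ.surjective x
      have hp : π p = 0 := by simpa using hx
      have key : (Ideal.Quotient.mkₐ K (Ideal.span (s : Set (MvPolynomial (Fin N) K)))).comp φ =
          ((Ideal.Quotient.mkₐ K (Ideal.span (s : Set (MvPolynomial (Fin N) K)))).comp φ).comp
            ((rename Sum.inr).comp π) := by
        refine MvPolynomial.algHom_ext fun i => ?_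
        rcases i with i | i
        · simp only [AlgHom.comp_apply, π, aeval_X, Sum.elim_inl, map_zero, φ, hbl]
          exact Ideal.Quotient.eq_zero_iff_mem.2 (Ideal.subset_span i.2)
        · simp [π]
      have := DFunLike.congr_fun key p
      simp only [AlgHom.comp_apply, hp, map_zero] at this
      exact Ideal.Quotient.eq_zero_iff_mem.1 this
    · rw [Ideal.span_le]
      intro f hf
      have : f = Φ (X (Sum.inl ⟨f, hf⟩)) := by
        simp [Φ, φ, hbl]
      rw [this]
      simp [RingHom.mem_ker, π]

end

/-! ### Linear primes and filtrations by linear primes -/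

section

variable {K : Type*} [Field K] {N : ℕ}

theorem IsLinear.isPrime {I : Ideal (MvPolynomial (Fin N) K)} {D : ℕ} (hI : IsLinear I D) :
    I.IsPrime := by
  obtain ⟨ψ, -, rfl⟩ := hI.exists_ker
  exact RingHom.ker_isPrime _

theorem IsLinear.ringKrullDim {I : Ideal (MvPolynomial (Fin N) K)} {D : ℕ} (hI : IsLinear I D) :
    ringKrullDim (MvPolynomial (Fin N) K ⧸ I) = D := by
  obtain ⟨ψ, hψ, rfl⟩ := hI.exists_ker
  rw [ringKrullDim_eq_of_ringEquiv (Ideal.quotientKerAlgEquivOfSurjective hψ).toRingEquiv,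
    MvPolynomial.ringKrullDim_of_isNoetherianRing, ringKrullDim_eq_zero_of_field, Nat.card_fin,
        zero_add]

theorem IsLinear.eq_of_eq {I : Ideal (MvPolynomial (Fin N) K)} {D D' : ℕ} (hI : IsLinear I D)
    (hI' : IsLinear I D') : D = D' := by
  have := hI.ringKrullDim.symm.trans hI'.ringKrullDim
  exact_mod_cast this

theorem IsLinear.isMaximal {I : Ideal (MvPolynomial (Fin N) K)} (hI : IsLinear I 0) :
    I.IsMaximal := by
  obtain ⟨ψ, hψ, rfl⟩ := hI.exists_ker
  have : RingHom.ker ψ = RingHom.ker ((isEmptyAlgEquiv K (Fin 0)).toAlgHom.comp ψ) := by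
    ext x
    rw [RingHom.mem_ker, RingHom.mem_ker]
    exact (map_eq_zero_iff _ (isEmptyAlgEquiv K (Fin 0)).injective).symm
  rw [this]
  exact RingHom.ker_isMaximal_of_surjective _ ((isEmptyAlgEquiv K (Fin 0)).surjective.comp hψ)

theorem IsLinear.isHomogeneousIdeal {I : Ideal (MvPolynomial (Fin N) K)} {D : ℕ}
    (hI : IsLinear I D) :
    IsHomogeneousIdeal I := by
  obtain ⟨s, hs, -, rfl, -⟩ := hI
  exact IsHomogeneousIdeal.span hs

theorem mem_span_X_of_isHomogeneous {f : MvPolynomial (Fin N) K} (hf : f.IsHomogeneous 1) :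
    f ∈ Ideal.span (Set.range (X : Fin N → MvPolynomial (Fin N) K)) := by
  rw [← mem_homogeneousSubmodule, homogeneousSubmodule_one_eq_span_X] at hf
  exact Submodule.span_le_restrictScalars K (MvPolynomial (Fin N) K) _ hf

theorem IsLinear.le_span_X {I : Ideal (MvPolynomial (Fin N) K)} {D : ℕ} (hI : IsLinear I D) :
    I ≤ Ideal.span (Set.range (X : Fin N → MvPolynomial (Fin N) K)) := by
  obtain ⟨s, hs, -, rfl, -⟩ := hI
  exact Ideal.span_le.2 fun f hf => mem_span_X_of_isHomogeneous (hs f hf)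

theorem card_le_of_linearIndepOn {s : Finset (MvPolynomial (Fin N) K)}
    (hs : ∀ f ∈ s, f.IsHomogeneous 1)
    (hli : LinearIndepOn K id (s : Set (MvPolynomial (Fin N) K))) : s.card ≤ N := by
  have h1 : Submodule.span K (s : Set (MvPolynomial (Fin N) K)) ≤ homogeneousSubmodule (Fin N) K
      1 :=
    Submodule.span_le.2 hs
  have h2 := Submodule.finrank_mono h1
  rwa [finrank_homogeneousSubmodule_one, finrank_span_finset_eq_card hli] at h2

theorem isLinear_span_X : IsLinear (Ideal.span (Set.range (X : Fin N → MvPolynomial (Fin N) K)))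
    0 := by
  classical
  refine ⟨Finset.univ.image X, ?_, ?_, by simp, ?_⟩
  · intro f hf
    obtain ⟨i, -, rfl⟩ := Finset.mem_image.1 hf
    exact isHomogeneous_X K i
  · simpa using (linearIndependent_X (Fin N) K).linearIndepOn_id
  · rw [Finset.card_image_of_injective _ X_injective, Finset.card_univ, Fintype.card_fin, add_zero]

theorem IsLinear.eq_span_X {I : Ideal (MvPolynomial (Fin N) K)} (hI : IsLinear I 0) :
    I = Ideal.span (Set.range (X : Fin N → MvPolynomial (Fin N) K)) :=
  hI.isMaximal.eq_of_le isLinear_span_X.isPrime.ne_top hI.le_span_X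

theorem IsLinear.exists_succ {I : Ideal (MvPolynomial (Fin N) K)} {D : ℕ}
    (hI : IsLinear I (D + 1)) :
    ∃ ℓ : MvPolynomial (Fin N) K, ℓ.IsHomogeneous 1 ∧ ℓ ∉ I ∧ IsLinear (I ⊔ Ideal.span {ℓ}) D := by
  classical
  obtain ⟨s, hs, hli, rfl, hcard⟩ := id hI
  obtain ⟨ℓ, hℓ, hℓs⟩ : ∃ ℓ ∈ homogeneousSubmodule (Fin N) K 1,
      ℓ ∉ Submodule.span K (s : Set (MvPolynomial (Fin N) K)) := by
    rw [← SetLike.not_le_iff_exists]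
    intro h
    have h2 := Submodule.finrank_mono h
    rw [finrank_homogeneousSubmodule_one, finrank_span_finset_eq_card hli] at h2
    omega
  have hmem : ℓ ∉ s := fun h => hℓs (Submodule.subset_span h)
  have hlin : IsLinear (Ideal.span (s : Set (MvPolynomial (Fin N) K)) ⊔ Ideal.span {ℓ}) D := by
    refine ⟨insert ℓ s, ?_, ?_, ?_, ?_⟩
    · exact Finset.forall_mem_insert _ _ _ |>.2 ⟨hℓ, hs⟩
    · rw [Finset.coe_insert]
      exact hli.id_insert hℓs
    · rw [Finset.coe_insert, Ideal.span_insert, sup_comm]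
    · rw [Finset.card_insert_of_notMem hmem]; omega
  refine ⟨ℓ, hℓ, fun h => ?_, hlin⟩
  rw [← Ideal.span_singleton_le_iff_mem] at h
  rw [sup_eq_left.2 h] at hlin
  have := hI.eq_of_eq hlin
  omega

theorem isLinear_of_linearIndepOn {ι : Type*} {f : ι → MvPolynomial (Fin N) K} {s : Finset ι}
    (hs : ∀ i ∈ s, (f i).IsHomogeneous 1) (hli : LinearIndepOn K f (s : Set ι)) :
    s.card ≤ N ∧ IsLinear (Ideal.span (f '' (s : Set ι))) (N - s.card) := by
  classical
  have h1 : ∀ g ∈ s.image f, g.IsHomogeneous 1 := fun g hg => by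
    obtain ⟨i, hi, rfl⟩ := Finset.mem_image.1 hg
    exact hs i hi
  have h2 : LinearIndepOn K id ((s.image f : Finset _) : Set (MvPolynomial (Fin N) K)) := by
    rw [Finset.coe_image]; exact hli.id_image
  have h3 : (s.image f).card = s.card := Finset.card_image_of_injOn hli.injOn
  have h4 := card_le_of_linearIndepOn h1 h2
  rw [h3] at h4
  exact ⟨h4, _, h1, h2, by rw [Finset.coe_image], by rw [h3]; omega⟩

/-- Linear forms in linearly general position are generic: the ideals they generate are linear
primes, and the codimension grows with each further form. -/
theorem isGeneric_of_linearIndepOn {f : ℕ ⊕ ℕ → MvPolynomial (Fin N) K} {W : Finset (ℕ ⊕ ℕ)} {C : ℕ}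
    (hf : ∀ i ∈ W, (f i).IsHomogeneous 1)
    (hli : ∀ s ⊆ W, s.card ≤ C + 1 → LinearIndepOn K f (s : Set (ℕ ⊕ ℕ))) : IsGeneric f W C := by
  intro s hs hC
  obtain ⟨h1, h2⟩ := isLinear_of_linearIndepOn (fun i hi => hf i (hs hi)) (hli s hs (by omega))
  refine ⟨h2.isPrime, fun i hi his hmem => ?_⟩
  have hsub : insert i s ⊆ W := Finset.insert_subset hi hs
  obtain ⟨h3, h4⟩ := isLinear_of_linearIndepOn (fun i hi => hf i (hsub hi))
    (hli _ hsub (by rw [Finset.card_insert_of_notMem his]; omega))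
  rw [Finset.coe_insert, Set.image_insert_eq, Ideal.span_insert,
    sup_eq_right.2 ((Ideal.span_singleton_le_iff_mem _).2 hmem)] at h4
  have := h2.eq_of_eq h4
  rw [Finset.card_insert_of_notMem his] at this h3
  omega

theorem hilbertSeries_top : hilbertSeries (⊤ : Ideal (MvPolynomial (Fin N) K)) = 0 := by
  ext d
  have h := hilbertFn_add_finrank (⊤ : Ideal (MvPolynomial (Fin N) K)) d
  have : formsIn (⊤ : Ideal (MvPolynomial (Fin N) K)) d = homogeneousSubmodule (Fin N) K d := by
    ext x; simp [mem_formsIn]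
  rw [this] at h
  simp only [hilbertSeries, PowerSeries.coeff_mk, map_zero]
  omega

theorem IsLinear.hilbertSeries_mul {I : Ideal (MvPolynomial (Fin N) K)} {D : ℕ}
    (hI : IsLinear I D) :
    hilbertSeries I * (1 - PowerSeries.X) ^ D = 1 := by
  induction D generalizing I with
  | zero =>
    have hX := hI.eq_span_X
    rw [pow_zero, mul_one]
    ext d
    rw [hilbertSeries, PowerSeries.coeff_mk, PowerSeries.coeff_one, hilbertFn]
    split_ifs with hd
    · subst hd
      have : (homogeneousSubmodule (Fin N) K 0).map (Ideal.Quotient.mkₐ K I).toLinearMap =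
          Submodule.span K {1} := by
        rw [homogeneousSubmodule_zero, Submodule.one_eq_span, Submodule.map_span,
            Set.image_singleton]
        simp
      rw [this, finrank_span_singleton]
      · rfl
      · have := Ideal.Quotient.nontrivial_iff.2 hI.isPrime.ne_top
        exact one_ne_zero
    · have : (homogeneousSubmodule (Fin N) K d).map (Ideal.Quotient.mkₐ K I).toLinearMap = ⊥ := by
        rw [eq_bot_iff]
        rintro _ ⟨f, hf, rfl⟩
        change Ideal.Quotient.mk I f = 0
        rw [Ideal.Quotient.eq_zero_iff_mem, hX, ← Set.image_univ, mem_ideal_span_X_image]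
        intro m hm
        by_contra! h
        have h0 : m = 0 := Finsupp.ext fun i => h i trivial
        have h1 := hf (mem_support_iff.1 hm)
        rw [h0] at h1
        simp at h1
        exact hd h1.symm
      rw [this, finrank_bot, Nat.cast_zero]
  | succ D ih =>
    obtain ⟨ℓ, hℓ, hℓI, hlin⟩ := hI.exists_succ
    have h1 := ih hlin
    rw [hilbertSeries_sup_span hI.isHomogeneousIdeal hℓ
      (fun h => hℓI (h ▸ zero_mem _)) (fun y hy => (hI.isPrime.mem_or_mem hy).resolve_left hℓI)]
          at h1
    rw [pow_succ', ← mul_assoc, h1]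

/-- `IsFilteredBy 𝒬 I F`: the quotient `R / I` has a finite filtration whose factors are the
quotients of `R` by ideals in `𝒬`, up to shifts of the degree, and the power series `F` counts these
shifts. Each step is an exact sequence `0 → (R / (I : ℓ))(-1) → R / I → R / (I + (ℓ)) → 0` with a
linear form `ℓ`. -/
inductive IsFilteredBy (𝒬 : Set (Ideal (MvPolynomial (Fin N) K))) :
    Ideal (MvPolynomial (Fin N) K) → PowerSeries ℤ → Prop
  | top : IsFilteredBy 𝒬 ⊤ 0
  | of_mem {Q} (hQ : Q ∈ 𝒬) : IsFilteredBy 𝒬 Q 1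
  | step {I I' : Ideal (MvPolynomial (Fin N) K)} {ℓ : MvPolynomial (Fin N) K} {F F' : PowerSeries ℤ}
      (hI : IsHomogeneousIdeal I) (hℓ : ℓ.IsHomogeneous 1) (hℓ0 : ℓ ≠ 0)
          (hcolon : ∀ y, ℓ * y ∈ I ↔ y ∈ I')
      (h : IsFilteredBy 𝒬 I' F) (h' : IsFilteredBy 𝒬 (I ⊔ Ideal.span {ℓ}) F') :
      IsFilteredBy 𝒬 I (PowerSeries.X * F + F')

theorem IsFilteredBy.hilbertSeries_mul {𝒬 : Set (Ideal (MvPolynomial (Fin N) K))} {D : ℕ}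
    (h𝒬 : ∀ Q ∈ 𝒬, IsLinear Q D) {I : Ideal (MvPolynomial (Fin N) K)} {F : PowerSeries ℤ}
    (h : IsFilteredBy 𝒬 I F) : hilbertSeries I * (1 - PowerSeries.X) ^ D = F := by
  induction h with
  | top => rw [hilbertSeries_top, zero_mul]
  | of_mem hQ => exact (h𝒬 _ hQ).hilbertSeries_mul
  | step hI hℓ hℓ0 hcolon _ _ ih ih' =>
    rw [hilbertSeries_eq hI hℓ hℓ0 hcolon, add_mul, mul_assoc, ih, ih']

/-- The generating series of a set of exponents by degree. -/
noncomputable def degreeSeries {c : ℕ} (A : Set (Fin c →₀ ℕ)) : PowerSeries ℤ :=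
  PowerSeries.mk fun d => ({a ∈ A | a.degree = d}.ncard : ℤ)

theorem degreeSeries_eq {c : ℕ} (A : Set (Fin (c + 1) →₀ ℕ)) :
    degreeSeries A = PowerSeries.X * degreeSeries (shiftSet A) + degreeSeries (sliceSet A 0) := by
  have h0 : ∀ d, {a ∈ A | a.degree = d} = (fun a => a + Finsupp.single 0 1) ''
      {a ∈ shiftSet A | a.degree + 1 = d} ∪
      Finsupp.cons 0 '' {a ∈ sliceSet A 0 | a.degree = d} := by
    intro d
    ext a
    constructor
    · rintro ⟨ha, rfl⟩
      induction a using expInduction with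
      | cons_zero a => exact Or.inr ⟨a, ⟨ha, by simp [degree_cons]⟩, rfl⟩
      | add_single a => exact Or.inl ⟨a, ⟨ha, by simp⟩, rfl⟩
    · rintro (⟨a, ⟨ha, hd⟩, rfl⟩ | ⟨a, ⟨ha, hd⟩, rfl⟩)
      · exact ⟨ha, by simpa using hd⟩
      · exact ⟨ha, by simpa [degree_cons] using hd⟩
  have hdisj : ∀ d, Disjoint ((fun a => a + Finsupp.single 0 1) ''
      {a ∈ shiftSet A | a.degree + 1 = d})
      (Finsupp.cons 0 '' {a ∈ sliceSet A 0 | a.degree = d}) := by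
    intro d
    rw [Set.disjoint_left]
    rintro _ ⟨a, -, rfl⟩ ⟨b, -, hb⟩
    have := DFunLike.congr_fun hb 0
    simp at this
  ext d
  rw [degreeSeries, PowerSeries.coeff_mk, h0, Set.ncard_union_eq (hdisj d)
    (((finite_degree_eq (c + 1) (d - 1)).subset fun a ha => by
      have := ha.2; simp only [Set.mem_ofPred_eq]; omega).image _)
    (((finite_degree_eq c d).subset fun a ha => ha.2).image _),
    Set.ncard_image_of_injective _ (add_left_injective _),
    Set.ncard_image_of_injective _ (Finsupp.cons_right_injective 0), map_add, degreeSeries,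
        degreeSeries]
  cases d with
  | zero => simp
  | succ d => simp [PowerSeries.coeff_succ_X_mul]

theorem isHomogeneousIdeal_configInter {f : ℕ ⊕ ℕ → MvPolynomial (Fin N) K} {W : Finset (ℕ ⊕ ℕ)}
    (hf : ∀ i ∈ W, (f i).IsHomogeneous 1) {U : Finset (ℕ ⊕ ℕ)} (hU : U ⊆ W) {c t : ℕ}
    (hk : KeysAvoid W U c t) (A : Set (Fin c →₀ ℕ)) :
        IsHomogeneousIdeal (configInter f U c t A) := by
  classical
  intro x hx d
  rw [mem_configInter] at hx ⊢
  intro a ha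
  have h1 := hx a ha
  rw [← Finset.coe_image] at h1 ⊢
  refine IsHomogeneousIdeal.span (fun g hg => ?_) x h1 d
  obtain ⟨i, hi, rfl⟩ := Finset.mem_image.1 hg
  exact hf i (Finset.union_subset hU (hk.keys_subset a) hi)

/-- The quotient by a configuration ideal is filtered by quotients by linear primes, with one factor
for each exponent `a ∈ A`, shifted by the degree of `a`. -/
theorem isFilteredBy_configInter {f : ℕ ⊕ ℕ → MvPolynomial (Fin N) K} {W : Finset (ℕ ⊕ ℕ)} {C : ℕ}
    (hf : ∀ i ∈ W, (f i).IsHomogeneous 1) (hgen : IsGeneric f W C) {U : Finset (ℕ ⊕ ℕ)} (hU : U ⊆ W)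
    {c t : ℕ} {A : Set (Fin c →₀ ℕ)} (hA : IsStronglyStable A) (hd : ∀ a ∈ A, a.degree ≤ t)
    (hk : KeysAvoid W U c t) (hC : U.card + c = C) :
    IsFilteredBy {Q | ∃ s ⊆ W, s.card = C ∧ Q = Ideal.span (f '' (s : Set (ℕ ⊕ ℕ)))}
      (configInter f U c t A) (degreeSeries A) := by
  have hempty : ∀ {c : ℕ}, degreeSeries (∅ : Set (Fin c →₀ ℕ)) = 0 := by
    intro c
    ext d
    simp [degreeSeries]
  induction c generalizing t U with
  | zero =>
    rcases A.eq_empty_or_nonempty with rfl | ⟨a, ha⟩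
    · rw [configInter_empty, hempty]; exact .top
    · have h1 : A = {0} := Set.eq_singleton_iff_nonempty_unique_mem.2
        ⟨⟨a, ha⟩, fun b _ => Subsingleton.elim _ _⟩
      have h2 : degreeSeries A = 1 := by
        ext d
        rw [degreeSeries, PowerSeries.coeff_mk, PowerSeries.coeff_one, h1]
        split_ifs with h
        · have : {b ∈ ({0} : Set (Fin 0 →₀ ℕ)) | b.degree = d} = {0} := by
            ext b
            exact ⟨fun hb => hb.1, fun hb => ⟨hb, by rw [Set.mem_singleton_iff.1 hb, h]; simp⟩⟩
          rw [this, Set.ncard_singleton, Nat.cast_one]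
        · have : {b ∈ ({0} : Set (Fin 0 →₀ ℕ)) | b.degree = d} = ∅ := by
            refine Set.eq_empty_of_forall_notMem ?_
            rintro b ⟨rfl, hb⟩
            exact h (by simpa using hb.symm)
          rw [this, Set.ncard_empty, Nat.cast_zero]
      have h3 : configInter f U 0 t A = Ideal.span (f '' (U : Set (ℕ ⊕ ℕ))) := by
        ext x; simp [mem_configInter, h1, keys]
      rw [h2, h3]
      exact .of_mem ⟨U, hU, hC, rfl⟩
  | succ c ihc =>
    induction t using Nat.strong_induction_on generalizing A with
    | _ t iht =>
    have hℓ := hk (c + 1) t (by omega) le_rfl le_rfl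
    rw [degreeSeries_eq]
    refine .step (ℓ := f (formKey (c + 1) t)) (isHomogeneousIdeal_configInter hf hU hk A)
        (hf _ hℓ.1) ?_
      (fun y => mul_mem_configInter_iff hgen hU hd hk hC.le) ?_ ?_
    · intro h0
      refine (hgen ∅ (by simp) (by simp)).2 _ hℓ.1 (by simp) ?_
      rw [h0]; exact zero_mem _
    · rcases Nat.eq_zero_or_pos t with rfl | ht
      · have : shiftSet A = ∅ := Set.eq_empty_of_forall_notMem fun a ha =>
          absurd (degree_lt_of_mem_shiftSet hd ha) (by omega)
        rw [this, configInter_empty, hempty]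
        exact .top
      · refine iht (t - 1) (by omega) hA.shiftSet (fun a ha => ?_) (hk.mono le_rfl (by omega))
        have := degree_lt_of_mem_shiftSet hd ha
        omega
    · rw [configInter_sup_span hgen hU hA hd hk hC.le]
      exact ihc (Finset.insert_subset hℓ.1 hU) (hA.sliceSet 0)
        (fun a ha => degree_le_of_mem_sliceSet hd ha) hk.insert
        (by rw [Finset.card_insert_of_notMem hℓ.2]; omega)

end

/-! ### Regular sequences -/

section

section Regular
variable {R : Type*} [CommRing R]

/-- Multiplication by `x` is injective on `R / I`. -/
def IsNonzerodivisorMod (I : Ideal R) (x : R) : Prop := ∀ y, x * y ∈ I → y ∈ I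

/-- `xs` is a weakly regular sequence on `R / I`. In contrast to
`RingTheory.Sequence.IsWeaklyRegular`, the recursion stays within the ideals of `R`. -/
def IsRegularMod : Ideal R → List R → Prop
  | _, [] => True
  | I, x :: xs => IsNonzerodivisorMod I x ∧ IsRegularMod (I ⊔ Ideal.span {x}) xs

theorem mem_sup_span {I : Ideal R} {x z : R} :
    z ∈ I ⊔ Ideal.span {x} ↔ ∃ w, z - x * w ∈ I := by
  constructor
  · intro h
    obtain ⟨i, hi, w, hw, rfl⟩ := Submodule.mem_sup.1 h
    obtain ⟨v, rfl⟩ := Ideal.mem_span_singleton.1 hw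
    exact ⟨v, by simpa using hi⟩
  · rintro ⟨w, hw⟩
    rw [← sub_add_cancel z (x * w)]
    exact Ideal.add_mem _ (Ideal.mem_sup_left hw)
      (Ideal.mem_sup_right (Ideal.mul_mem_right _ _ (Ideal.mem_span_singleton_self x)))

/-- Comparison of `IsRegularMod` with the notion in Mathlib. -/
theorem isWeaklyRegular_quotient_iff {I : Ideal R} {xs : List R} :
    RingTheory.Sequence.IsWeaklyRegular (R ⧸ I) xs ↔ IsRegularMod I xs := by
  induction xs generalizing I with
  | nil => simp [IsRegularMod]
  | cons x xs ih =>
    rw [RingTheory.Sequence.isWeaklyRegular_cons_iff, IsRegularMod, ← ih]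
    refine and_congr ?_ ?_
    · rw [isSMulRegular_iff_right_eq_zero_of_smul]
      constructor
      · intro h y hy
        rw [← Ideal.Quotient.eq_zero_iff_mem]
        exact h _ (Ideal.Quotient.eq_zero_iff_mem.2 hy)
      · intro h y hy
        obtain ⟨y, rfl⟩ := Ideal.Quotient.mk_surjective y
        exact Ideal.Quotient.eq_zero_iff_mem.2 (h y (Ideal.Quotient.eq_zero_iff_mem.1 hy))
    · let φ : R →ₗ[R] QuotSMulTop x (R ⧸ I) := (Submodule.mkQ _).comp (Submodule.mkQ I)
      have hφ : Function.Surjective φ :=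
        (Submodule.mkQ_surjective _).comp (Submodule.mkQ_surjective _)
      have hker : LinearMap.ker φ = I ⊔ Ideal.span {x} := by
        ext z
        rw [LinearMap.mem_ker, mem_sup_span]
        change Submodule.Quotient.mk (Ideal.Quotient.mk I z) = 0 ↔ _
        rw [Submodule.Quotient.mk_eq_zero, Submodule.mem_smul_pointwise_iff_exists]
        constructor
        · rintro ⟨y, -, hy⟩
          obtain ⟨y, rfl⟩ := Ideal.Quotient.mk_surjective y
          exact ⟨y, Ideal.Quotient.eq.1 hy.symm⟩
        · rintro ⟨w, hw⟩
          exact ⟨Ideal.Quotient.mk I w, trivial, (Ideal.Quotient.eq.2 hw).symm⟩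
      let e := φ.quotKerEquivOfSurjective hφ
      rw [hker] at e
      exact (e.isWeaklyRegular_congr xs).symm

/-- In an exact sequence `0 → R / (I : ℓ) → R / I → R / (I + (ℓ)) → 0`, a sequence which is weakly
regular on both ends is weakly regular on the middle. -/
theorem IsRegularMod.of_colon {I I' : Ideal R} {ℓ : R} (hcolon : ∀ y, ℓ * y ∈ I ↔ y ∈ I')
    {xs : List R}
    (h : IsRegularMod I' xs) (h' : IsRegularMod (I ⊔ Ideal.span {ℓ}) xs) : IsRegularMod I xs := by
  induction xs generalizing I I' with
  | nil => trivial
  | cons x xs ih =>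
    refine ⟨fun y hy => ?_, ih (I' := I' ⊔ Ideal.span {x}) (fun y => ⟨fun hy => ?_, fun hy => ?_⟩)
        h.2 ?_⟩
    · obtain ⟨z, hz⟩ := mem_sup_span.1 (h'.1 y (Ideal.mem_sup_left hy))
      have h1 : ℓ * (x * z) ∈ I := by
        have := I.sub_mem hy (I.mul_mem_left x hz)
        convert this using 1; ring
      have h2 := (hcolon z).2 (h.1 z ((hcolon _).1 h1))
      simpa using I.add_mem hz h2
    · obtain ⟨w, hw⟩ := mem_sup_span.1 hy
      have h1 : x * w ∈ I ⊔ Ideal.span {ℓ} := by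
        refine mem_sup_span.2 ⟨y, ?_⟩
        simpa using I.neg_mem hw
      obtain ⟨v, hv⟩ := mem_sup_span.1 (h'.1 w h1)
      refine mem_sup_span.2 ⟨v, (hcolon _).1 ?_⟩
      have := I.add_mem hw (I.mul_mem_left x hv)
      convert this using 1; ring
    · obtain ⟨w, hw⟩ := mem_sup_span.1 hy
      refine mem_sup_span.2 ⟨ℓ * w, ?_⟩
      have := (hcolon _).2 hw
      convert this using 1; ring
    · rw [sup_right_comm]; exact h'.2

theorem IsNonzerodivisorMod.swap {I : Ideal R} {x y : R} (hx : IsNonzerodivisorMod I x)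
    (hy : IsNonzerodivisorMod (I ⊔ Ideal.span {x}) y) :
    IsNonzerodivisorMod (I ⊔ Ideal.span {y}) x := by
  intro z hz
  obtain ⟨w, hw⟩ := mem_sup_span.1 hz
  have h1 : y * w ∈ I ⊔ Ideal.span {x} := mem_sup_span.2 ⟨z, by simpa using I.neg_mem hw⟩
  obtain ⟨v, hv⟩ := mem_sup_span.1 (hy w h1)
  refine mem_sup_span.2 ⟨v, hx _ ?_⟩
  have := I.add_mem hw (I.mul_mem_left y hv)
  convert this using 1; ring

/-- There is a weakly regular sequence of length `k` on `R / I` in `𝔪`. -/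
def HasDepth (𝔪 I : Ideal R) (k : ℕ) : Prop :=
  ∃ xs : List R, xs.length = k ∧ (∀ x ∈ xs, x ∈ 𝔪) ∧ IsRegularMod I xs

theorem HasDepth.cons {𝔪 I : Ideal R} {k : ℕ} {x : R} (hx : x ∈ 𝔪) (hI : IsNonzerodivisorMod I x)
    (h : HasDepth 𝔪 (I ⊔ Ideal.span {x}) k) : HasDepth 𝔪 I (k + 1) := by
  obtain ⟨xs, rfl, hxs, hreg⟩ := h
  exact ⟨x :: xs, rfl, by simpa using ⟨hx, hxs⟩, hI, hreg⟩

theorem HasDepth.exists_cons {𝔪 I : Ideal R} {k : ℕ} (h : HasDepth 𝔪 I (k + 1)) :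
    ∃ x ∈ 𝔪, IsNonzerodivisorMod I x ∧ HasDepth 𝔪 (I ⊔ Ideal.span {x}) k := by
  obtain ⟨xs, hlen, hxs, hreg⟩ := h
  cases xs with
  | nil => simp at hlen
  | cons x xs =>
    exact ⟨x, hxs x (by simp), hreg.1, xs, by simpa using hlen, fun y hy => hxs y (by simp [hy]),
        hreg.2⟩

variable [IsNoetherianRing R] {𝔪 : Ideal R}

/-- The zerodivisors on `R / I` are the elements of the associated primes. -/
theorem isNonzerodivisorMod_iff {I : Ideal R} {x : R} :
    IsNonzerodivisorMod I x ↔ ∀ P ∈ associatedPrimes R (R ⧸ I), x ∉ P := by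
  have h := biUnion_associatedPrimes_eq_zero_divisors R (R ⧸ I)
  have h1 : (∃ P ∈ associatedPrimes R (R ⧸ I), x ∈ P) ↔ ∃ z : R ⧸ I, z ≠ 0 ∧ x • z = 0 := by
    have := Set.ext_iff.1 h x
    simpa using this
  rw [← not_iff_not]
  push Not
  rw [h1]
  simp only [IsNonzerodivisorMod]
  push Not
  constructor
  · rintro ⟨y, hy, hyI⟩
    exact ⟨Ideal.Quotient.mk I y, fun h => hyI (Ideal.Quotient.eq_zero_iff_mem.1 h),
      Ideal.Quotient.eq_zero_iff_mem.2 hy⟩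
  · rintro ⟨z, hz, hxz⟩
    obtain ⟨y, rfl⟩ := Ideal.Quotient.mk_surjective z
    exact ⟨y, Ideal.Quotient.eq_zero_iff_mem.1 hxz,
        fun h => hz (Ideal.Quotient.eq_zero_iff_mem.2 h)⟩

/-- By prime avoidance, finitely many quotients which each have a nonzerodivisor in `𝔪` have a
common one. -/
theorem exists_isNonzerodivisorMod {S : Set (Ideal R)} (hS : S.Finite)
    (h : ∀ I ∈ S, ∃ x ∈ 𝔪, IsNonzerodivisorMod I x) : ∃ x ∈ 𝔪, ∀ I ∈ S,
        IsNonzerodivisorMod I x := by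
  have hfin : (⋃ I ∈ S, associatedPrimes R (R ⧸ I)).Finite :=
    hS.biUnion fun I _ => associatedPrimes.finite R (R ⧸ I)
  by_contra! hcon
  have hsub : (𝔪 : Set R) ⊆ ⋃ P ∈ ⋃ I ∈ S, associatedPrimes R (R ⧸ I), (id P : Ideal R) := by
    intro x hx
    obtain ⟨I, hI, hxI⟩ := hcon x hx
    rw [isNonzerodivisorMod_iff] at hxI
    push Not at hxI
    obtain ⟨P, hP, hxP⟩ := hxI
    simp only [Set.mem_iUnion]
    exact ⟨P, ⟨I, hI, hP⟩, hxP⟩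
  rw [Ideal.subset_union_prime_finite hfin ⊤ ⊤] at hsub
  · obtain ⟨P, hP, hle⟩ := hsub
    simp only [Set.mem_iUnion] at hP
    obtain ⟨I, hI, hPI⟩ := hP
    obtain ⟨x, hx, hxI⟩ := h I hI
    exact isNonzerodivisorMod_iff.1 hxI P hPI (hle hx)
  · intro P hP _ _
    simp only [Set.mem_iUnion] at hP
    obtain ⟨I, hI, hPI⟩ := hP
    exact hPI.isPrime

/-- If `𝔪` consists of zerodivisors on `R / I`, then `R / I` has a nonzero element annihilated by
`𝔪`. -/
theorem exists_socle {I : Ideal R} (h : ¬ ∃ x ∈ 𝔪, IsNonzerodivisorMod I x) :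
    ∃ u ∉ I, ∀ a ∈ 𝔪, a * u ∈ I := by
  have hsub : (𝔪 : Set R) ⊆ ⋃ P ∈ associatedPrimes R (R ⧸ I), (id P : Ideal R) := by
    intro x hx
    have hxI : ¬ IsNonzerodivisorMod I x := fun hxI => h ⟨x, hx, hxI⟩
    rw [isNonzerodivisorMod_iff] at hxI
    push Not at hxI
    obtain ⟨P, hP, hxP⟩ := hxI
    simp only [Set.mem_iUnion]
    exact ⟨P, hP, hxP⟩
  rw [Ideal.subset_union_prime_finite (f := id) (associatedPrimes.finite R (R ⧸ I)) ⊤ ⊤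
    fun P hP _ _ => hP.isPrime] at hsub
  obtain ⟨P, hP, hle⟩ := hsub
  obtain ⟨hprime, z, hz⟩ := isAssociatedPrime_iff.1 hP
  obtain ⟨u, rfl⟩ := Ideal.Quotient.mk_surjective z
  have hmem : ∀ a, a ∈ P ↔ a * u ∈ I := fun a => by
    rw [hz, Submodule.mem_colon_singleton, Submodule.mem_bot, ← Ideal.Quotient.eq_zero_iff_mem]
    rfl
  refine ⟨u, fun hu => hprime.ne_top ?_, fun a ha => (hmem a).1 (hle ha)⟩
  rw [Ideal.eq_top_iff_one, hmem, one_mul]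
  exact hu

/-- Whether depth is left after dividing by one nonzerodivisor in `𝔪` does not depend on the
nonzerodivisor: the socles of `R / (I + (x))` and `R / (I + (y))` are isomorphic, by sending the
class of `u` to the class of the `w` with `x u ≡ y w` modulo `I`. -/
theorem exists_isNonzerodivisorMod_sup {I : Ideal R} {x y : R} (hx𝔪 : x ∈ 𝔪)
    (hx : IsNonzerodivisorMod I x) (hy : IsNonzerodivisorMod I y)
    (h : ∃ z ∈ 𝔪, IsNonzerodivisorMod (I ⊔ Ideal.span {x}) z) :
    ∃ z ∈ 𝔪, IsNonzerodivisorMod (I ⊔ Ideal.span {y}) z := by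
  by_contra hcon
  -- For a socle element `u` modulo `y`, write `x u ≡ y w`; then `𝔪 w` vanishes modulo `x`, hence so
  -- does `w`, and cancelling `x` shows that `u` vanishes modulo `y`.
  obtain ⟨u, hu, hsoc⟩ := exists_socle hcon
  obtain ⟨w, hw⟩ := mem_sup_span.1 (hsoc x hx𝔪)
  obtain ⟨b, hb, hbreg⟩ := h
  have hwx : w ∈ I ⊔ Ideal.span {x} := by
    refine hbreg w ?_
    obtain ⟨z, hz⟩ := mem_sup_span.1 (hsoc b hb)
    refine mem_sup_span.2 ⟨z, hy _ ?_⟩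
    have := I.sub_mem (I.mul_mem_left x hz) (I.mul_mem_left b hw)
    convert this using 1; ring
  obtain ⟨z, hz⟩ := mem_sup_span.1 hwx
  refine hu (mem_sup_span.2 ⟨z, hx _ ?_⟩)
  have := I.add_mem hw (I.mul_mem_left y hz)
  convert this using 1; ring

/-- Dividing by a nonzerodivisor in `𝔪` lowers the depth by at most one. -/
theorem HasDepth.sup_span {I : Ideal R} {k : ℕ} {x : R} (h : HasDepth 𝔪 I (k + 1))
    (hx𝔪 : x ∈ 𝔪) (hx : IsNonzerodivisorMod I x) : HasDepth 𝔪 (I ⊔ Ideal.span {x}) k := by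
  induction k generalizing I x with
  | zero => exact ⟨[], rfl, by simp, trivial⟩
  | succ k ih =>
    obtain ⟨x₁, hx₁𝔪, hx₁, hdep⟩ := h.exists_cons
    obtain ⟨x₂, hx₂𝔪, hx₂, -⟩ := hdep.exists_cons
    have h1 := exists_isNonzerodivisorMod_sup hx₁𝔪 hx₁ hx ⟨x₂, hx₂𝔪, hx₂⟩
    -- Exchange `x₁` for `x` through an element `y` which is regular on all quotients involved.
    obtain ⟨y, hy𝔪, hy⟩ := exists_isNonzerodivisorMod (𝔪 := 𝔪)
      (S := {I, I ⊔ Ideal.span {x₁}, I ⊔ Ideal.span {x}}) (by simp) (by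
        rintro J (rfl | rfl | rfl)
        · exact ⟨x, hx𝔪, hx⟩
        · exact ⟨x₂, hx₂𝔪, hx₂⟩
        · exact h1)
    have hyI := hy I (by simp)
    have hyx₁ := hy (I ⊔ Ideal.span {x₁}) (by simp)
    have hyx := hy (I ⊔ Ideal.span {x}) (by simp)
    have h2 : HasDepth 𝔪 (I ⊔ Ideal.span {y}) (k + 1) := by
      refine .cons hx₁𝔪 (hx₁.swap hyx₁) ?_
      rw [sup_right_comm]
      exact ih hdep hy𝔪 hyx₁
    refine .cons hy𝔪 hyx ?_
    rw [sup_right_comm]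
    exact ih h2 hx𝔪 (hx.swap hyx)

/-- Finitely many quotients of depth at least `k` have a common weakly regular sequence of length
`k`. No assumption on the cardinality of the base field is needed, since the elements of the
sequence may have any degree. -/
theorem exists_common_isRegularMod {k : ℕ} {S : Set (Ideal R)} (hS : S.Finite)
    (h : ∀ I ∈ S, HasDepth 𝔪 I k) :
    ∃ xs : List R, xs.length = k ∧ (∀ x ∈ xs, x ∈ 𝔪) ∧ ∀ I ∈ S, IsRegularMod I xs := by
  induction k generalizing S with
  | zero => exact ⟨[], rfl, by simp, fun _ _ => trivial⟩
  | succ k ih =>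
    obtain ⟨y, hy𝔪, hy⟩ := exists_isNonzerodivisorMod (𝔪 := 𝔪) hS fun I hI => by
      obtain ⟨x, hx, hxI, -⟩ := (h I hI).exists_cons
      exact ⟨x, hx, hxI⟩
    obtain ⟨xs, hlen, hxs, hreg⟩ := ih (hS.image fun I => I ⊔ Ideal.span {y}) (by
      rintro _ ⟨I, hI, rfl⟩
      exact (h I hI).sup_span hy𝔪 (hy I hI))
    exact ⟨y :: xs, by simp [hlen], by simpa using ⟨hy𝔪, hxs⟩,
      fun I hI => ⟨hy I hI, hreg _ ⟨I, hI, rfl⟩⟩⟩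

end Regular

variable {K : Type*} [Field K] {N : ℕ}

theorem IsLinear.hasDepth {I : Ideal (MvPolynomial (Fin N) K)} {D : ℕ} (hI : IsLinear I D) :
    HasDepth (Ideal.span (Set.range X)) I D := by
  induction D generalizing I with
  | zero => exact ⟨[], rfl, by simp, trivial⟩
  | succ D ih =>
    obtain ⟨ℓ, hℓ, hℓI, hlin⟩ := hI.exists_succ
    exact .cons (mem_span_X_of_isHomogeneous hℓ)
      (fun y hy => (hI.isPrime.mem_or_mem hy).resolve_left hℓI) (ih hlin)

/-- A sequence which is weakly regular on all factors of a filtration is weakly regular on the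
filtered quotient. -/
theorem IsFilteredBy.isRegularMod {𝒬 : Set (Ideal (MvPolynomial (Fin N) K))}
    {xs : List (MvPolynomial (Fin N) K)} (h𝒬 : ∀ Q ∈ 𝒬, IsRegularMod Q xs)
    {I : Ideal (MvPolynomial (Fin N) K)} {F : PowerSeries ℤ} (h : IsFilteredBy 𝒬 I F) :
    IsRegularMod I xs := by
  induction h with
  | top =>
    clear h𝒬
    induction xs with
    | nil => trivial
    | cons x xs ih => exact ⟨fun _ _ => trivial, by rwa [top_sup_eq]⟩
  | of_mem hQ => exact h𝒬 _ hQ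
  | step _ _ _ hcolon _ _ ih ih' => exact ih.of_colon hcolon ih'

theorem IsFilteredBy.exists_isRegularMod {𝒬 : Set (Ideal (MvPolynomial (Fin N) K))}
    (hfin : 𝒬.Finite)
    {D : ℕ} (h𝒬 : ∀ Q ∈ 𝒬, IsLinear Q D) {I : Ideal (MvPolynomial (Fin N) K)} {F : PowerSeries ℤ}
    (h : IsFilteredBy 𝒬 I F) : HasDepth (Ideal.span (Set.range X)) I D := by
  obtain ⟨xs, hlen, hxs, hreg⟩ := exists_common_isRegularMod hfin
    fun Q hQ => (h𝒬 Q hQ).hasDepth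
  exact ⟨xs, hlen, hxs, h.isRegularMod hreg⟩

theorem isRegular_of_isRegularMod {I 𝔪 : Ideal (MvPolynomial (Fin N) K)} (h𝔪 : 𝔪 ≠ ⊤) (hI : I ≤ 𝔪)
    {xs : List (MvPolynomial (Fin N) K)} (hxs : ∀ x ∈ xs, x ∈ 𝔪) (h : IsRegularMod I xs) :
    RingTheory.Sequence.IsRegular (MvPolynomial (Fin N) K ⧸ I) xs := by
  refine ⟨isWeaklyRegular_quotient_iff.2 h, fun htop => h𝔪 ?_⟩
  have h1 : (Ideal.ofList xs • ⊤ : Submodule (MvPolynomial (Fin N) K) (MvPolynomial (Fin N) K ⧸ I))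
      ≤
      Submodule.map (Submodule.mkQ I) 𝔪 := by
    rw [Submodule.smul_le]
    intro r hr z _
    obtain ⟨z, rfl⟩ := Submodule.mkQ_surjective I z
    rw [← map_smul]
    exact Submodule.mem_map_of_mem (𝔪.mul_mem_right _ (Ideal.span_le.2 hxs hr))
  rw [← htop] at h1
  obtain ⟨a, ha, ha1⟩ := h1 (show Submodule.mkQ I 1 ∈ _ from trivial)
  have h2 : a - 1 ∈ I := Ideal.Quotient.eq.1 ha1
  rw [Ideal.eq_top_iff_one]
  have := 𝔪.sub_mem ha (hI h2)
  simpa using this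

theorem hilbertSeries_sup_ofList {I : Ideal (MvPolynomial (Fin N) K)} (hI : IsHomogeneousIdeal I)
    {ls : List (MvPolynomial (Fin N) K)} (hls : ∀ l ∈ ls, l.IsHomogeneous 1)
        (h : IsRegularMod I ls) :
    hilbertSeries (I ⊔ Ideal.ofList ls) = hilbertSeries I * (1 - PowerSeries.X) ^ ls.length := by
  induction ls generalizing I with
  | nil => simp
  | cons l ls ih =>
    have hl := hls l (by simp)
    rw [Ideal.ofList_cons, ← sup_assoc, ih (hI.sup_span hl) (fun x hx => hls x (by simp [hx])) h.2,
      List.length_cons, pow_succ', ← mul_assoc]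
    congr 1
    -- A weakly regular sequence may contain `0` if the quotient is zero.
    by_cases hl0 : l = 0
    · have hItop : I = ⊤ := by
        rw [Ideal.eq_top_iff_one]
        exact h.1 1 (by rw [hl0, zero_mul]; exact zero_mem _)
      rw [hItop, top_sup_eq, hilbertSeries_top, zero_mul]
    · exact hilbertSeries_sup_span hI hl hl0 h.1

end

/-! ### The components of the configuration -/

section

/-- The keys in increasing order of the codimension index; the parameters `u` are `t` minus the
partial sums of `a`. -/
theorem exists_keys_eq_image (c t : ℕ) (a : Fin c →₀ ℕ) :
    ∃ u : ℕ → ℕ, Monotone u ∧ (∀ k, u k ≤ t) ∧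
      keys c t a = (Finset.range c).image fun k => formKey (k + 1) (u k) := by
  induction c generalizing t with
  | zero => exact ⟨fun _ => 0, monotone_const, fun _ => Nat.zero_le _, by simp [keys]⟩
  | succ c ih =>
    obtain ⟨u, hu, hle, hk⟩ := ih (t - a 0) a.tail
    refine ⟨fun k => if k < c then u k else t - a 0, ?_, ?_, ?_⟩
    · intro k l hkl
      dsimp only
      split_ifs with h1 h2
      · exact hu hkl
      · exact hle k
      · omega
      · exact le_rfl
    · intro k
      dsimp only
      split_ifs
      · exact (hle k).trans (by omega)
      · omega
    · rw [keys, hk, Finset.range_add_one, Finset.image_insert]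
      simp only [lt_irrefl, if_false]
      congr 1
      refine Finset.image_congr fun k hk => ?_
      simp only [Finset.coe_range, Set.mem_Iio] at hk
      simp only [if_pos hk]

theorem card_keys (c t : ℕ) (a : Fin c →₀ ℕ) : (keys c t a).card = c := by
  induction c generalizing t with
  | zero => simp [keys]
  | succ c ih => rw [keys, Finset.card_insert_of_notMem (formKey_notMem_keys _ _ _), ih]

/-- The position of a form in the order `M_0 < L_0 < M_1 < L_1 < ...`. -/
def weight : ℕ ⊕ ℕ → ℕ := Sum.elim (fun m => 2 * m) fun l => 2 * l + 1

theorem weight_injective : Function.Injective weight := by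
  rintro (m | m) (l | l) h <;> simp only [weight, Sum.elim_inl, Sum.elim_inr] at h
  · rw [show m = l by omega]
  · omega
  · omega
  · rw [show m = l by omega]

theorem weight_formKey (k u : ℕ) : weight (formKey (k + 1) u) = 2 * u + k := by
  unfold formKey
  split_ifs with h
  · rw [Nat.even_iff] at h
    simp only [weight, Sum.elim_inr]
    omega
  · rw [Nat.not_even_iff] at h
    simp only [weight, Sum.elim_inl]
    omega

/-- In increasing order, parities alternate, starting with an even element. -/
def IsAlternating (S : Finset ℕ) : Prop :=
  ∀ w ∈ S, w % 2 = (S.filter (· < w)).card % 2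

theorem isAlternating_image_keys (c t : ℕ) (a : Fin c →₀ ℕ) :
    IsAlternating ((keys c t a).image weight) := by
  obtain ⟨u, hu, -, hk⟩ := exists_keys_eq_image c t a
  have hmono : StrictMono fun k => 2 * u k + k := by
    intro k l hkl
    have := hu hkl.le
    dsimp only
    omega
  have h1 : (keys c t a).image weight = (Finset.range c).image fun k => 2 * u k + k := by
    rw [hk, Finset.image_image]
    exact Finset.image_congr fun k _ => weight_formKey k _
  rw [h1]
  intro w hw
  obtain ⟨k, hk, rfl⟩ := Finset.mem_image.1 hw
  rw [Finset.mem_range] at hk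
  have h2 : ((Finset.range c).image fun k => 2 * u k + k).filter (· < 2 * u k + k) =
      (Finset.range k).image fun k => 2 * u k + k := by
    ext x
    simp only [Finset.mem_filter, Finset.mem_image, Finset.mem_range]
    constructor
    · rintro ⟨⟨l, -, rfl⟩, hlt⟩
      exact ⟨l, hmono.lt_iff_lt.1 hlt, rfl⟩
    · rintro ⟨l, hl, rfl⟩
      exact ⟨⟨l, hl.trans hk, rfl⟩, hmono hl⟩
  rw [h2, Finset.card_image_of_injective _ hmono.injective, Finset.card_range]
  omega

/-- If `p < q < r`, removing `p` and removing `r` place `q` at positions of different parities. -/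
theorem not_isAlternating_erase {U : Finset ℕ} {p q r : ℕ} (hp : p ∈ U) (hq : q ∈ U) (hpq : p < q)
    (hqr : q < r) (h : IsAlternating (U.erase p)) (h' : IsAlternating (U.erase r)) : False := by
  have h1 := h q (Finset.mem_erase.2 ⟨hpq.ne', hq⟩)
  have h2 := h' q (Finset.mem_erase.2 ⟨hqr.ne, hq⟩)
  rw [Finset.filter_erase, Finset.card_erase_of_mem (Finset.mem_filter.2 ⟨hp, hpq⟩)] at h1
  rw [Finset.filter_erase, Finset.erase_eq_of_notMem (by simp [hqr.not_gt])] at h2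
  have h3 : 0 < (U.filter (· < q)).card := Finset.card_pos.2 ⟨p, Finset.mem_filter.2 ⟨hp, hpq⟩⟩
  omega

/-- Three different alternating sets with `c` elements span at least `c + 2` elements: otherwise
they arise from a set with `c + 1` elements by removing three different elements, and the smallest
and the largest of these contradict `not_isAlternating_erase`. -/
theorem card_union_of_isAlternating {c : ℕ} {S₁ S₂ S₃ : Finset ℕ} (h₁ : IsAlternating S₁)
    (h₂ : IsAlternating S₂) (h₃ : IsAlternating S₃) (hc₁ : S₁.card = c) (hc₂ : S₂.card = c)
    (hc₃ : S₃.card = c) (h₁₂ : S₁ ≠ S₂) (h₁₃ : S₁ ≠ S₃) (h₂₃ : S₂ ≠ S₃) :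
    c + 2 ≤ (S₁ ∪ S₂ ∪ S₃).card := by
  by_contra! hlt
  set U := S₁ ∪ S₂ ∪ S₃
  have hs₁ : S₁ ⊆ U := fun x hx => by simp [U, hx]
  have hs₂ : S₂ ⊆ U := fun x hx => by simp [U, hx]
  have hs₃ : S₃ ⊆ U := fun x hx => by simp [U, hx]
  have hU : U.card = c + 1 := by
    have : c < U.card := by
      by_contra! hle
      exact h₁₂ ((Finset.eq_of_subset_of_card_le hs₁ (by omega)).trans
        (Finset.eq_of_subset_of_card_le hs₂ (by omega)).symm)
    omega
  have key : ∀ S ⊆ U, S.card = c → ∃ p ∈ U, S = U.erase p := by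
    intro S hS hcard
    have h1 : (U \ S).card = 1 := by rw [Finset.card_sdiff_of_subset hS]; omega
    obtain ⟨p, hp⟩ := Finset.card_eq_one.1 h1
    have hpU : p ∈ U \ S := by rw [hp]; exact Finset.mem_singleton_self p
    rw [Finset.mem_sdiff] at hpU
    refine ⟨p, hpU.1, ?_⟩
    rw [Finset.erase_eq, ← hp, Finset.sdiff_sdiff_eq_self hS]
  obtain ⟨p, hp, hp'⟩ := key S₁ hs₁ hc₁
  obtain ⟨q, hq, hq'⟩ := key S₂ hs₂ hc₂
  obtain ⟨r, hr, hr'⟩ := key S₃ hs₃ hc₃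
  rw [hp'] at h₁ h₁₂ h₁₃
  rw [hq'] at h₂ h₁₂ h₂₃
  rw [hr'] at h₃ h₁₃ h₂₃
  have hpq : p ≠ q := fun h => h₁₂ (by rw [h])
  have hpr : p ≠ r := fun h => h₁₃ (by rw [h])
  have hqr : q ≠ r := fun h => h₂₃ (by rw [h])
  rcases hpq.lt_or_gt with h | h <;> rcases hpr.lt_or_gt with h' | h' <;>
    rcases hqr.lt_or_gt with h'' | h'' <;> try omega
  · exact not_isAlternating_erase hp hq h h'' h₁ h₃
  · exact not_isAlternating_erase hp hr h' h'' h₁ h₂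
  · exact not_isAlternating_erase hr hp h' h h₃ h₂
  · exact not_isAlternating_erase hq hp h h' h₂ h₃
  · exact not_isAlternating_erase hq hr h'' h' h₂ h₁
  · exact not_isAlternating_erase hr hq h'' h h₃ h₁

/-- Three different components involve at least `c + 2` of the linear forms. -/
theorem card_union_keys {c t : ℕ} {a b e : Fin c →₀ ℕ} (hab : keys c t a ≠ keys c t b)
    (hae : keys c t a ≠ keys c t e) (hbe : keys c t b ≠ keys c t e) :
    c + 2 ≤ (keys c t a ∪ keys c t b ∪ keys c t e).card := by
  rw [← Finset.card_image_of_injective _ weight_injective, Finset.image_union, Finset.image_union]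
  have hcard : ∀ a, ((keys c t a).image weight).card = c := fun a => by
    rw [Finset.card_image_of_injective _ weight_injective, card_keys]
  have hne : ∀ {S S' : Finset (ℕ ⊕ ℕ)}, S ≠ S' → S.image weight ≠ S'.image weight :=
    fun h h' => h (Finset.image_injective weight_injective h')
  exact card_union_of_isAlternating (isAlternating_image_keys c t a)
      (isAlternating_image_keys c t b)
    (isAlternating_image_keys c t e) (hcard a) (hcard b) (hcard e) (hne hab) (hne hae) (hne hbe)

theorem keysAvoid_formIndices (c t : ℕ) : KeysAvoid (formIndices c t) ∅ c t := by
  intro r u h1 h2 h3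
  refine ⟨?_, by simp⟩
  unfold formKey formIndices
  split_ifs with h
  · rw [Nat.even_iff] at h
    rw [Finset.inr_mem_disjSum, Finset.mem_range]
    omega
  · rw [Nat.not_even_iff] at h
    rw [Finset.inl_mem_disjSum, Finset.mem_range]
    omega

section
variable {K : Type*} [Field K]

/-- Each component belongs to an admissible sequence of indices, namely to `u_k + ⌊k / 2⌋`, where
the parameters `u_k` are weakly increasing. -/
theorem maxConfigIdeal_le {n c t : ℕ} (M L : ℕ → MvPolynomial (Fin (n + 1)) K)
    (A : Set (Fin c →₀ ℕ)) :
    maxConfigIdeal M L c t ≤ configInter (Sum.elim M L) ∅ c t A := by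
  intro x hx
  rw [mem_configInter]
  intro a _
  obtain ⟨u, hu, hle, hk⟩ := exists_keys_eq_image c t a
  have hadm : IsAdmissible c t fun k : Fin c => u k + k / 2 := by
    refine ⟨fun k => ?_, fun k l hkl => ?_⟩
    · have := hle k
      have := k.2
      dsimp only
      omega
    · have := @hu k l (by omega)
      split_ifs with h
      · rw [Nat.even_iff] at h
        dsimp only
        omega
      · rw [Nat.not_even_iff] at h
        dsimp only
        omega
  have h1 := (Submodule.mem_iInf _).1 ((Submodule.mem_iInf _).1 hx _) hadm
  refine Ideal.span_le.2 ?_ h1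
  rintro _ ⟨k, rfl⟩
  refine Ideal.subset_span ⟨formKey (k + 1) (u k), ?_, ?_⟩
  · rw [Finset.empty_union, hk]
    exact Finset.mem_coe.2 (Finset.mem_image.2 ⟨k, Finset.mem_range.2 k.2, rfl⟩)
  · rw [elim_formKey]
    dsimp only
    by_cases h : Even (k : ℕ)
    · rw [if_pos h, if_neg (by rw [Nat.even_add_one]; simpa using h)]
      rfl
    · rw [if_neg h, if_pos (by rw [Nat.even_add_one]; exact h)]
      rw [Nat.not_even_iff] at h
      congr 2
      omega

variable {N : ℕ}

theorem exists_le_of_iInf_le {R ι : Type*} [CommRing R] {s : Set ι} (hs : s.Finite)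
    {Q : ι → Ideal R} {P : Ideal R}
    (hP : P.IsPrime) (h : ⨅ i ∈ s, Q i ≤ P) : ∃ i ∈ s, Q i ≤ P := by
  have h1 : hs.toFinset.inf Q ≤ P := by
    rw [Finset.inf_eq_iInf]
    simpa using h
  obtain ⟨i, hi, hle⟩ := (Ideal.IsPrime.inf_le' hP).1 h1
  exact ⟨i, by simpa using hi, hle⟩

theorem ringKrullDim_iInf {R ι : Type*} [CommRing R] {s : Set ι} (hs : s.Finite) (hne : s.Nonempty)
    {Q : ι → Ideal R} {D : ℕ} (h : ∀ i ∈ s, ringKrullDim (R ⧸ Q i) = D) :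
    ringKrullDim (R ⧸ ⨅ i ∈ s, Q i) = D := by
  apply le_antisymm
  · rw [ringKrullDim_quotient]
    refine iSup_le fun p => ?_
    obtain ⟨i, hi, hle⟩ := exists_le_of_iInf_le hs p.head.1.2 p.head.2
    rw [← h i hi, ringKrullDim_quotient]
    let q : LTSeries (PrimeSpectrum.zeroLocus (Q i : Set R)) :=
      { length := p.length
        toFun := fun k => ⟨(p k).1, hle.trans (p.monotone (Fin.zero_le k))⟩
        step := fun k => p.step k }
    exact le_iSup (fun p : LTSeries (PrimeSpectrum.zeroLocus (Q i : Set R)) =>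
      (p.length : WithBot ℕ∞)) q
  · obtain ⟨i, hi⟩ := hne
    rw [← h i hi]
    exact ringKrullDim_le_of_surjective (Ideal.Quotient.factor (iInf₂_le i hi))
      (Ideal.Quotient.factor_surjective _)

theorem mem_of_minimalPrimes_iInf {R ι : Type*} [CommRing R] {s : Set ι} (hs : s.Finite)
    {Q : ι → Ideal R} (hQ : ∀ i ∈ s, (Q i).IsPrime) {P : Ideal R}
    (hP : P ∈ (⨅ i ∈ s, Q i).minimalPrimes) : ∃ i ∈ s, P = Q i := by
  obtain ⟨i, hi, hle⟩ := exists_le_of_iInf_le hs hP.1.1 hP.1.2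
  exact ⟨i, hi, le_antisymm (hP.2 ⟨hQ i hi, iInf₂_le i hi⟩ hle) hle⟩

theorem isRadical_iInf {R ι : Type*} [CommRing R] {s : Set ι} {Q : ι → Ideal R}
    (hQ : ∀ i ∈ s, (Q i).IsPrime) : (⨅ i ∈ s, Q i).IsRadical := by
  rintro x ⟨k, hk⟩
  simp only [Submodule.mem_iInf] at hk ⊢
  exact fun i hi => (hQ i hi).mem_of_pow_mem k (hk i hi)

/-- An intersection of linear primes other than the irrelevant ideal is saturated. -/
theorem mem_iInf_of_forall_X_mul_mem {ι : Type*} {s : Set ι}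
    {Q : ι → Ideal (MvPolynomial (Fin N) K)} {D : ℕ}
    (hD : 0 < D) (hQ : ∀ i ∈ s, IsLinear (Q i) D) {f : MvPolynomial (Fin N) K}
    (hf : ∀ j, X j * f ∈ ⨅ i ∈ s, Q i) : f ∈ ⨅ i ∈ s, Q i := by
  simp only [Submodule.mem_iInf] at hf ⊢
  intro i hi
  by_contra hfi
  have h1 : Ideal.span (Set.range X) ≤ Q i := by
    rw [Ideal.span_le]
    rintro _ ⟨j, rfl⟩
    exact ((hQ i hi).isPrime.mem_or_mem (hf j i hi)).resolve_right hfi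
  have h2 := (hQ i hi).le_span_X.antisymm h1
  have h3 := hQ i hi
  rw [h2] at h3
  have := h3.eq_of_eq isLinear_span_X
  omega

end

end

/-! ### The properties of the configuration -/

section

section
variable {K : Type*} [Field K] {n c t : ℕ} {M L : ℕ → MvPolynomial (Fin (n + 1)) K}

theorem sum_elim_isHomogeneous (hM : ∀ i < t + (c + 1) / 2, (M i).IsHomogeneous 1)
    (hL : ∀ i < t + c / 2, (L i).IsHomogeneous 1) :
    ∀ i ∈ formIndices c t, (Sum.elim M L i).IsHomogeneous 1 := by
  rintro (i | i) hi
  · rw [formIndices, Finset.inl_mem_disjSum, Finset.mem_range] at hi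
    exact hM i hi
  · rw [formIndices, Finset.inr_mem_disjSum, Finset.mem_range] at hi
    exact hL i hi

theorem degree_le_of_mem_stdExps_lexIdeal {v : ℕ} {h : ℕ → ℕ} (H : IsLexHilbertFn K c h)
    (hv : ∀ i, v < i → h i = 0) {a : Fin c →₀ ℕ} (ha : a ∈ stdExps (lexIdeal K c h)) :
        a.degree ≤ v :=
  H.lexIdeal_spec.1.degree_le_of_mem_stdExps (fun i hi => by rw [H.lexIdeal_spec.2.2, hv i hi]) ha

theorem stdExps_lexIdeal_nonempty {h : ℕ → ℕ} (H : IsLexHilbertFn K c h) (h0 : h 0 ≠ 0) :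
    (stdExps (lexIdeal K c h)).Nonempty := by
  have h1 := H.lexIdeal_spec.2.2 0
  rw [hilbertFn_eq_ncard H.lexIdeal_spec.1.isMonomial] at h1
  obtain ⟨a, ha, -⟩ := Set.nonempty_of_ncard_ne_zero (h1.trans_ne h0)
  exact ⟨a, ha⟩

theorem configIdeal_eq_configInter_of_isOSequence {v : ℕ} (hc : 1 ≤ c) (hvt : v ≤ t) {h : ℕ → ℕ}
    (hO : IsOSequence h) (hv0 : ∀ i, v < i → h i = 0) (hhc : h 1 ≤ c)
    (hgen : IsGeneric (Sum.elim M L) (formIndices c t) c) :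
    IsLexHilbertFn K c h ∧
      configIdeal M L c t h = configInter (Sum.elim M L) ∅ c t (stdExps (lexIdeal K c h)) := by
  obtain ⟨c, rfl⟩ : ∃ e, c = e + 1 := ⟨c - 1, by omega⟩
  have H : IsLexHilbertFn K (c + 1) h := .of_isOSequence hO hhc hv0
  refine ⟨H, configIdeal_eq_configInter hgen le_rfl (keysAvoid_formIndices _ _) H ?_ fun a ha => ?_⟩
  · exact stdExps_lexIdeal_nonempty H (by rw [hO.1]; exact one_ne_zero)
  · exact (degree_le_of_mem_stdExps_lexIdeal H hv0 ha).trans hvt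

theorem configInter_antitone {R : Type*} [CommRing R] (f : ℕ ⊕ ℕ → R) (U : Finset (ℕ ⊕ ℕ))
    {A B : Set (Fin c →₀ ℕ)}
    (h : A ⊆ B) : configInter f U c t B ≤ configInter f U c t A := fun _ hx =>
  mem_configInter.2 fun a ha => mem_configInter.1 hx a (h ha)

theorem isLinear_keys (hf : ∀ i ∈ formIndices c t, (Sum.elim M L i).IsHomogeneous 1)
    (hgen : InGeneralPosition M L c t (c + 1)) {s : Finset (ℕ ⊕ ℕ)} (hs : s ⊆ formIndices c t)
    (hcard : s.card = c) :
    IsLinear (Ideal.span (Sum.elim M L '' (s : Set (ℕ ⊕ ℕ)))) (n + 1 - c) := by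
  have := (isLinear_of_linearIndepOn (fun i hi => hf i (hs hi)) (hgen s hs (by omega))).2
  rwa [hcard] at this

/-- The Hilbert series determines the Hilbert functions of all Artinian reductions. -/
theorem hVector_of_hilbertSeries {I : Ideal (MvPolynomial (Fin (n + 1)) K)}
    (hI : IsHomogeneousIdeal I)
    {D : ℕ} {h : ℕ → ℕ} (hdim : ringKrullDim (MvPolynomial (Fin (n + 1)) K ⧸ I) = D)
    (hser : hilbertSeries I * (1 - PowerSeries.X) ^ D = PowerSeries.mk fun i => (h i : ℤ)) :
    IsHVector I h := by
  refine ⟨D, hdim, hser, fun ls hlen hls hreg i => ?_⟩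
  have h1 := hilbertSeries_sup_ofList hI hls (isWeaklyRegular_quotient_iff.1 hreg.toIsWeaklyRegular)
  rw [hlen, hser] at h1
  have h2 := congrArg (PowerSeries.coeff i) h1
  rw [hilbertSeries, PowerSeries.coeff_mk, PowerSeries.coeff_mk] at h2
  exact_mod_cast h2

/-- Three components which together involve at least `c + 2` independent forms intersect in
dimension at most `n - c - 2`. -/
theorem ringKrullDim_sup_add_one_le (hf : ∀ i ∈ formIndices c t, (Sum.elim M L i).IsHomogeneous 1)
    (hgen : InGeneralPosition M L c t (c + 2)) {s₁ s₂ s₃ : Finset (ℕ ⊕ ℕ)}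
        (hs₁ : s₁ ⊆ formIndices c t)
    (hs₂ : s₂ ⊆ formIndices c t) (hs₃ : s₃ ⊆ formIndices c t)
        (hcard : c + 2 ≤ (s₁ ∪ s₂ ∪ s₃).card) :
    ringKrullDim (MvPolynomial (Fin (n + 1)) K ⧸
      (Ideal.span (Sum.elim M L '' (s₁ : Set (ℕ ⊕ ℕ))) ⊔ Ideal.span
          (Sum.elim M L '' (s₂ : Set (ℕ ⊕ ℕ))) ⊔
        Ideal.span (Sum.elim M L '' (s₃ : Set (ℕ ⊕ ℕ))))) + 1 ≤ ((n - c : ℕ) : WithBot ℕ∞) := by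
  obtain ⟨s, hs, hsc⟩ := Finset.exists_subset_card_eq hcard
  have hsW : s ⊆ formIndices c t := hs.trans (Finset.union_subset (Finset.union_subset hs₁ hs₂) hs₃)
  obtain ⟨hle, hlin⟩ := isLinear_of_linearIndepOn (fun i hi => hf i (hsW hi)) (hgen s hsW hsc.le)
  rw [← Ideal.span_union, ← Ideal.span_union, ← Set.image_union, ← Set.image_union,
    ← Finset.coe_union, ← Finset.coe_union]
  have h1 := ringKrullDim_le_of_surjective (Ideal.Quotient.factor
      (span_image_mono (f := Sum.elim M L) hs))
    (Ideal.Quotient.factor_surjective _)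
  rw [hlin.ringKrullDim] at h1
  refine (add_le_add_left h1 1).trans ?_
  have h2 : n + 1 - s.card + 1 ≤ n - c := by omega
  exact_mod_cast h2

end

end

end LexConfig

theorem mainTheorem7 {K : Type*} [Field K] (n c t v : ℕ) (hc : 1 ≤ c) (hcn : c ≤ n) (hvt : v ≤ t)
    (h : ℕ → ℕ) (hO : LexConfig.IsOSequence h) (hv : h v ≠ 0) (hv0 : ∀ i, v < i → h i = 0)
    (hhc : h 1 ≤ c)
    (M L : ℕ → MvPolynomial (Fin (n + 1)) K)
    (hM : ∀ i < t + (c + 1) / 2, (M i).IsHomogeneous 1)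
    (hL : ∀ i < t + c / 2, (L i).IsHomogeneous 1)
    (hgen : LexConfig.InGeneralPosition M L c t (c + 1)) :
    (LexConfig.IsSaturatedHomogeneous (LexConfig.configIdeal M L c t h) ∧
      (LexConfig.configIdeal M L c t h).IsRadical ∧
      LexConfig.IsACM (LexConfig.configIdeal M L c t h) ∧
      LexConfig.HasCodim (LexConfig.configIdeal M L c t h) c ∧
      LexConfig.maxConfigIdeal M L c t ≤ LexConfig.configIdeal M L c t h ∧
      LexConfig.IsHVector (LexConfig.configIdeal M L c t h) h) ∧
    (LexConfig.InGeneralPosition M L c t (c + 2) →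
      LexConfig.IsGeneralizedStickFigure (LexConfig.configIdeal M L c t h)) ∧
    (∀ (v' : ℕ) (h' : ℕ → ℕ), LexConfig.IsOSequence h' → h' v' ≠ 0 → (∀ i, v' < i → h' i = 0) →
      v' ≤ v → (∀ i ≤ v', h' i ≤ h i) →
      LexConfig.configIdeal M L c t h ≤ LexConfig.configIdeal M L c t h') := by
  open LexConfig in
  classical
  have hf := sum_elim_isHomogeneous hM hL
  have hgeneric : IsGeneric (Sum.elim M L) (formIndices c t) c := isGeneric_of_linearIndepOn hf hgen
  obtain ⟨H, hconf⟩ := configIdeal_eq_configInter_of_isOSequence hc hvt hO hv0 hhc hgeneric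
  have hJ := H.lexIdeal_spec.1
  set A := stdExps (lexIdeal K c h)
  have hd : ∀ a ∈ A, a.degree ≤ t := fun a ha =>
    (degree_le_of_mem_stdExps_lexIdeal H hv0 ha).trans hvt
  have hAfin : A.Finite := finite_of_degree_le hd
  have hAne : A.Nonempty := stdExps_lexIdeal_nonempty H (by rw [hO.1]; exact one_ne_zero)
  have hk := keysAvoid_formIndices c t
  let Q : (Fin c →₀ ℕ) → Ideal (MvPolynomial (Fin (n + 1)) K) := fun a =>
    Ideal.span (Sum.elim M L '' (keys c t a : Set (ℕ ⊕ ℕ)))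
  have hQ : ∀ a ∈ A, IsLinear (Q a) (n + 1 - c) := fun a _ =>
    isLinear_keys hf hgen (hk.keys_subset a) (card_keys c t a)
  have hIQ : configIdeal M L c t h = ⨅ a ∈ A, Q a := by
    rw [hconf]; simp only [configInter, Finset.empty_union, Q]
  have hhom : IsHomogeneousIdeal (configIdeal M L c t h) :=
    hconf ▸ isHomogeneousIdeal_configInter hf (by simp) hk A
  have hdim : ringKrullDim (MvPolynomial (Fin (n + 1)) K ⧸ configIdeal M L c t h) =
      (n + 1 - c : ℕ) :=
    hIQ ▸ ringKrullDim_iInf hAfin hAne fun a ha => (hQ a ha).ringKrullDim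
  have hrad : (configIdeal M L c t h).IsRadical := hIQ ▸ isRadical_iInf fun a ha =>
      (hQ a ha).isPrime
  have hfilt := isFilteredBy_configInter hf hgeneric (Finset.empty_subset _) hJ.isStronglyStable hd
      hk (by simp)
  rw [← hconf] at hfilt
  have h𝒬 : ∀ P ∈ {Q | ∃ s ⊆ formIndices c t, s.card = c ∧ Q = Ideal.span
      (Sum.elim M L '' (s : Set (ℕ ⊕ ℕ)))},
      IsLinear P (n + 1 - c) := by
    rintro _ ⟨s, hs, hcard, rfl⟩
    exact isLinear_keys hf hgen hs hcard
  refine ⟨⟨⟨hhom, fun f hX => ?_⟩, hrad, ?_, ?_, ?_, ?_⟩, fun hgen2 => ⟨hrad, n - c, ?_, ?_⟩, ?_⟩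
  · rw [hIQ] at hX ⊢
    exact mem_iInf_of_forall_X_mul_mem (by omega) hQ hX
  · have hfin : {Q | ∃ s ⊆ formIndices c t, s.card = c ∧
        Q = Ideal.span (Sum.elim M L '' (s : Set (ℕ ⊕ ℕ)))}.Finite := by
      refine ((formIndices c t).powerset.finite_toSet.image fun s : Finset (ℕ ⊕ ℕ) =>
        Ideal.span (Sum.elim M L '' (s : Set (ℕ ⊕ ℕ)))).subset ?_
      rintro _ ⟨s, hs, -, rfl⟩
      exact ⟨s, Finset.mem_coe.2 (Finset.mem_powerset.2 hs), rfl⟩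
    obtain ⟨xs, hlen, hxs, hreg⟩ := hfilt.exists_isRegularMod hfin h𝒬
    refine ⟨xs, hxs, isRegular_of_isRegularMod isLinear_span_X.isPrime.ne_top ?_ hxs hreg, ?_⟩
    · obtain ⟨a, ha⟩ := hAne
      rw [hIQ]
      exact (iInf₂_le a ha).trans (hQ a ha).le_span_X
    · rw [hdim, hlen]
  · rw [HasCodim, hdim]
    have : n + 1 - c + c = n + 1 := by omega
    exact_mod_cast this
  · rw [hconf]; exact maxConfigIdeal_le M L A
  · refine hVector_of_hilbertSeries hhom hdim ?_
    rw [hfilt.hilbertSeries_mul h𝒬, degreeSeries]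
    ext d
    rw [PowerSeries.coeff_mk, PowerSeries.coeff_mk, ← hilbertFn_eq_ncard hJ.isMonomial,
      H.lexIdeal_spec.2.2]
  · intro P hP
    rw [hIQ] at hP
    obtain ⟨a, ha, rfl⟩ := mem_of_minimalPrimes_iInf hAfin (fun a ha => (hQ a ha).isPrime) hP
    refine ⟨⟨Sum.elim M L '' (keys c t a : Set (ℕ ⊕ ℕ)), ?_, rfl⟩, ?_⟩
    · rintro _ ⟨i, hi, rfl⟩
      exact hf i (hk.keys_subset a hi)
    · rw [(hQ a ha).ringKrullDim, show n + 1 - c = n - c + 1 by omega]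
  · intro P₁ hP₁ P₂ hP₂ P₃ hP₃ h₁₂ h₁₃ h₂₃
    rw [hIQ] at hP₁ hP₂ hP₃
    have hprime : ∀ a ∈ A, (Q a).IsPrime := fun a ha => (hQ a ha).isPrime
    obtain ⟨a, -, rfl⟩ := mem_of_minimalPrimes_iInf hAfin hprime hP₁
    obtain ⟨b, -, rfl⟩ := mem_of_minimalPrimes_iInf hAfin hprime hP₂
    obtain ⟨e, -, rfl⟩ := mem_of_minimalPrimes_iInf hAfin hprime hP₃
    have hne : ∀ {a b}, Q a ≠ Q b → keys c t a ≠ keys c t b := fun hab h =>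
      hab (by simp only [Q, h])
    exact ringKrullDim_sup_add_one_le hf hgen2 (hk.keys_subset a) (hk.keys_subset b)
      (hk.keys_subset e) (card_union_keys (hne h₁₂) (hne h₁₃) (hne h₂₃))
  · intro v' h' hO' _ hv0' hv'v hle
    have hle' : ∀ i, h' i ≤ h i := fun i => by
      by_cases hi : i ≤ v'
      · exact hle i hi
      · rw [hv0' i (not_le.1 hi)]; exact Nat.zero_le _
    obtain ⟨H', hconf'⟩ := configIdeal_eq_configInter_of_isOSequence hc (hv'v.trans hvt) hO' hv0'
      ((hle' 1).trans hhc) hgeneric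
    rw [hconf, hconf']
    refine configInter_antitone _ _ (H'.lexIdeal_spec.1.stdExps_subset hJ fun d => ?_)
    rw [H'.lexIdeal_spec.2.2, H.lexIdeal_spec.2.2]
    exact hle' d
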